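/- Let $H$ be a complex Hilbert space and let $T=(T_1,\dots,T_n)\in L(H)^n$ be a pure row contraction: the $T_i$ commute, the row operator $T:H^n\to H$, $(x_i)\mapsto\sum_i T_ix_i$, is a contraction, and $\sigma_T^k(1_H)\to 0$ strongly as $k\to\infty$, where $\sigma_T(X)=\sum_i T_iXT_i^*$. Put $D_T=(1_{H^n}-T^*T)^{1/2}$, $D_{T^*}=(1_H-TT^*)^{1/2}$, $\mathcal D_T=\overline{D_TH^n}$, $\mathcal D_{T^*}=\overline{D_{T^*}H}$. Let $\mathbb B\subset\mathbb C^n$ be the open Euclidean unit ball and, for $z\in\mathbb B$, let $Z:H^n\to H$, $(x_i)\mapsto\sum_i z_ix_i$. The characteristic function of $T$ is $$\theta_T:\mathbb B\to L(\mathcal D_T,\mathcal D_{T^*}),\qquad \theta_T(z)=-T+D_{T^*}(1_H-ZT^*)^{-1}ZD_T .$$ For $m\ge 1$ let $H_m(\mathbb B,\mathcal E)$ be the $\mathcal E$-valued functional Hilbert space on $\mathbb B$ with reproducing kernel $1_{\mathcal E}/(1-\langle z,w\rangle)^m$, and let $M_z=(M_{z_1},\dots,M_{z_n})$ be the tuple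 of multiplications with the coordinate functions. For an $m$-hypercontraction $T$, i.e. a commuting tuple with $\Delta_T^{(k)}=(1-\sigma_T)^k(1_H)\ge 0$ for $1\le k\le m$, of class $C_{\cdot 0}$ (that is, with $\sigma_T^k(1_H)\to0$ strongly), let $C=(\Delta_T^{(m)})^{1/2}$, $\mathcal D=\overline{CH}$, let $j:H\to H_m(\mathbb B,\mathcal D)$, $(jx)(z)=C(1_H-ZT^*)^{-m}x$, and $$M=H_m(\mathbb B,\mathcal D)\ominus \operatorname{Im} j,\qquad W(M)=M\ominus\Big(\sum_{i=1}^n M_{z_i}M\Big).$$ Let $\tilde H$ be $H$ with the scalar product $(x,y)=\sum_{k=0}^{m-1}\langle\Delta_T^{(k)}x,y\rangle$, let $I_m:H\to\tilde H$, $x\mapsto x$, let $\tilde T:\tilde H^n\to H$ be the row contraction with components $T_iI_m^*$, and let $D_{\tilde T}=(1_{\tilde H^n}-\tilde T^*\tilde T)^{1/2}$, $\mathcal D_{\tilde T}=\overline{D_{\tilde T}\tilde H^n}$, $$\tilde{\mathcal D}=\{y\in\mathcal D_{\tilde T}:\ (\oplus\, jI_m^{-1})D_{\tilde T}y\in M_z^*H_m(\mathbb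 B,\mathcal D)\},$$ where $M_z^*f=(M_{z_i}^*f)_{i=1}^n$, and, with $Z$ also denoting the operator $\tilde H^n\to\tilde H$, $(x_i)\mapsto\sum_i z_ix_i$, $$W_T:\mathbb B\to L(\tilde{\mathcal D},\mathcal D),\qquad W_T(z)y=-\tilde Ty+C\sum_{k=1}^m(1_H-ZT^*)^{-k}I_m^{-1}ZD_{\tilde T}y .$$ A pure row contraction is a $1$-hypercontraction of class $C_{\cdot0}$. Form the objects above for it with $m=1$. Then $\mathcal D=\mathcal D_{T^*}$; the identity $\tilde H=H$ identifies $\tilde{\mathcal D}$ isometrically with a subspace of $\mathcal D_T$; with this identification $$W_T(z)=\theta_T(z)|_{\tilde{\mathcal D}}\qquad(z\in\mathbb B);$$ and $x\mapsto M_{\theta_T}x$, where $(M_{\theta_T}x)(z)=\theta_T(z)x$, is a unitary operator from $\tilde{\mathcal D}$ onto the wandering subspace $W(M)\subset H_1(\mathbb B,\mathcal D_{T^*})$. -/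

import Mathlib

open scoped InnerProductSpace InnerProduct Topology ComplexOrder

noncomputable section

namespace RowContraction

/-! ### Row operators and defect spaces -/

/-- The row operator `E^n → F`, `(x_i) ↦ ∑ i, A_i x_i`; here `E^n` is the Hilbert space direct sum. -/
def row {E F : Type*} [NormedAddCommGroup E] [InnerProductSpace ℂ E]
    [NormedAddCommGroup F] [InnerProductSpace ℂ F] {n : ℕ} (A : Fin n → E →L[ℂ] F) :
    PiLp 2 (fun _ : Fin n => E) →L[ℂ] F :=
  ∑ i, A i ∘L PiLp.proj 2 (fun _ : Fin n => E) i

/-- The row operator `Z : E^n → E`, `(x_i) ↦ ∑ i, z_i x_i`. -/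
def zRow (E : Type*) [NormedAddCommGroup E] [InnerProductSpace ℂ E] {n : ℕ}
    (z : EuclideanSpace ℂ (Fin n)) : PiLp 2 (fun _ : Fin n => E) →L[ℂ] E :=
  row fun i => z i • ContinuousLinearMap.id ℂ E

/-- The closure of the range of a bounded operator on a Hilbert space. -/
def closedRange {E F : Type*} [NormedAddCommGroup E] [InnerProductSpace ℂ E]
    [NormedAddCommGroup F] [InnerProductSpace ℂ F] (A : E →L[ℂ] F) : Submodule ℂ F :=
  A.range.topologicalClosure

instance {E F : Type*} [NormedAddCommGroup E] [InnerProductSpace ℂ E]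
    [NormedAddCommGroup F] [InnerProductSpace ℂ F] [CompleteSpace F] (A : E →L[ℂ] F) :
    CompleteSpace (closedRange A) :=
  inferInstanceAs (CompleteSpace A.range.topologicalClosure)

lemma mem_closedRange {E F : Type*} [NormedAddCommGroup E] [InnerProductSpace ℂ E]
    [NormedAddCommGroup F] [InnerProductSpace ℂ F] (A : E →L[ℂ] F) (x : E) :
    A x ∈ closedRange A :=
  Submodule.le_topologicalClosure _ ⟨x, rfl⟩

section Defect

variable {E F : Type*} [NormedAddCommGroup E] [InnerProductSpace ℂ E] [CompleteSpace E]
  [NormedAddCommGroup F] [InnerProductSpace ℂ F] [CompleteSpace F]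

/-- The defect operator `D_A = (1 - A⋆ A)^{1/2}` of a contraction `A`. -/
def defectOp (A : E →L[ℂ] F) : E →L[ℂ] E := CFC.sqrt (1 - A† ∘L A)

/-- The defect space, the closure of `D_A E`. -/
def defectSpace (A : E →L[ℂ] F) : Submodule ℂ E := closedRange (defectOp A)

instance (A : E →L[ℂ] F) : CompleteSpace (defectSpace A) :=
  inferInstanceAs (CompleteSpace (closedRange _))

lemma one_sub_nonneg {A : E →L[ℂ] F} (hA : ‖A‖ ≤ 1) : 0 ≤ 1 - A† ∘L A := by
  rw [ContinuousLinearMap.nonneg_iff_isPositive, ContinuousLinearMap.isPositive_def']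
  refine ⟨?_, fun x => ?_⟩
  · rw [ContinuousLinearMap.isSelfAdjoint_iff']
    ext1 x
    refine ext_inner_right ℂ fun y => ?_
    simp [ContinuousLinearMap.adjoint_inner_left, inner_sub_left]
  · have h1 : ‖A x‖ ≤ ‖x‖ := by simpa using A.le_of_opNorm_le hA x
    have h2 : ‖A x‖ ^ 2 ≤ ‖x‖ ^ 2 := by gcongr
    simp only [ContinuousLinearMap.reApplyInnerSelf_apply, sub_apply,
      inner_sub_left, map_sub, ContinuousLinearMap.comp_apply, ContinuousLinearMap.adjoint_inner_left,
      one_apply_eq_self, inner_self_eq_norm_sq]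
    linarith

lemma contraction_maps_defectSpace {A : E →L[ℂ] F} (hA : ‖A‖ ≤ 1) {x : E}
    (hx : x ∈ defectSpace A) : A x ∈ defectSpace (A†) := by
  have hA' : ‖A†‖ ≤ 1 := by simpa using hA
  have hP := one_sub_nonneg hA
  have hQ := one_sub_nonneg hA'
  have hPP : defectOp A * defectOp A = 1 - A† ∘L A := CFC.sqrt_mul_sqrt_self _ hP
  have hQQ : defectOp (A†) * defectOp (A†) = 1 - (A†)† ∘L A† := CFC.sqrt_mul_sqrt_self _ hQ
  have hPs : (defectOp A)† = defectOp A :=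
    (CFC.sqrt_nonneg (1 - A† ∘L A)).isSelfAdjoint
  have hQs : (defectOp (A†))† = defectOp (A†) :=
    (CFC.sqrt_nonneg (1 - (A†)† ∘L A†)).isSelfAdjoint
  have hker : ∀ v, defectOp (A†) v = 0 → defectOp A ((A†) v) = 0 := by
    intro v hv
    have h1 : v - A ((A†) v) = 0 := by
      have := congrArg (fun B : F →L[ℂ] F => B v) hQQ
      simpa [hv] using this.symm
    have h2 : ‖defectOp A ((A†) v)‖ ^ 2 = 0 := by
      have h3 : defectOp A (defectOp A ((A†) v)) = 0 := by
        have := congrArg (fun B : E →L[ℂ] E => B ((A†) v)) hPP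
        simp only [sub_apply, one_apply_eq_self, ContinuousLinearMap.comp_apply, ← map_sub, h1,
          map_zero] at this
        exact this
      rw [← inner_self_eq_norm_sq (𝕜 := ℂ), ← ContinuousLinearMap.adjoint_inner_left, hPs, h3]
      simp
    simpa using h2
  have hrange : ∀ y, A (defectOp A y) ∈ closedRange (defectOp (A†)) := by
    intro y
    rw [closedRange, ← Submodule.orthogonal_orthogonal_eq_closure,
      ContinuousLinearMap.orthogonal_range, hQs]
    intro v hv
    rw [← ContinuousLinearMap.adjoint_inner_left, ← ContinuousLinearMap.adjoint_inner_left, hPs,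
      hker v (by simpa using hv)]
    simp
  have hcl : IsClosed ((closedRange (defectOp (A†)) : Set F)) :=
    Submodule.isClosed_topologicalClosure _
  exact closure_minimal (s := ((defectOp A).range : Set E))
    (t := A ⁻¹' (closedRange (defectOp (A†)) : Set F))
    (by rintro _ ⟨y, rfl⟩; exact hrange y) (hcl.preimage A.continuous) hx

end Defect

/-! ### The functional Hilbert spaces with kernel `(1 - ⟨z,w⟩)^{-m}` -/

/-- The open Euclidean unit ball of `ℂ^n`. -/
abbrev UnitBall (n : ℕ) : Type := Metric.ball (0 : EuclideanSpace ℂ (Fin n)) 1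

/-- The scalar product `⟨z,w⟩ = ∑ i, z_i conj(w_i)`. -/
def ballInner {n : ℕ} (z w : UnitBall n) : ℂ :=
  ∑ i, (z : EuclideanSpace ℂ (Fin n)) i * starRingEnd ℂ ((w : EuclideanSpace ℂ (Fin n)) i)

/-- The kernel `K_m(z,w) = 1_E / (1 - ⟨z,w⟩)^m`. -/
def ballKernel (n m : ℕ) (E : Type*) [NormedAddCommGroup E] [InnerProductSpace ℂ E] :
    Matrix (UnitBall n) (UnitBall n) (E →L[ℂ] E) :=
  .of fun z w => ((1 - ballInner z w) ^ m)⁻¹ • ContinuousLinearMap.id ℂ E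

section Positivity

variable {X : Type*} {n : ℕ} {E : Type*} [NormedAddCommGroup E] [InnerProductSpace ℂ E]

/-- Positive definiteness of the operator valued kernel `κ • 1_E`. -/
def PosKernel (E : Type*) [NormedAddCommGroup E] [InnerProductSpace ℂ E]
    (κ : X → X → ℂ) : Prop :=
  ∀ (s : Finset X) (v : X → E), 0 ≤ (∑ x ∈ s, ∑ y ∈ s, κ y x * ⟪v y, v x⟫_ℂ).re

lemma PosKernel.one : PosKernel E (fun _ _ : X => (1 : ℂ)) := by
  intro s v
  have : ∑ x ∈ s, ∑ y ∈ s, (1 : ℂ) * ⟪v y, v x⟫_ℂ = ⟪∑ y ∈ s, v y, ∑ x ∈ s, v x⟫_ℂ := by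
    simp only [sum_inner, inner_sum, one_mul]
  rw [this]
  exact inner_self_nonneg (𝕜 := ℂ)

lemma PosKernel.zero : PosKernel E (fun _ _ : X => (0 : ℂ)) := by
  intro s v; simp

lemma PosKernel.add {κ κ' : X → X → ℂ} (h : PosKernel E κ) (h' : PosKernel E κ') :
    PosKernel E (fun x y => κ x y + κ' x y) := by
  intro s v
  simpa [add_mul, Finset.sum_add_distrib] using add_nonneg (h s v) (h' s v)

lemma PosKernel.sum {ι : Type*} {κ : ι → X → X → ℂ} (t : Finset ι)
    (h : ∀ i ∈ t, PosKernel E (κ i)) : PosKernel E (fun x y => ∑ i ∈ t, κ i x y) := by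
  classical
  induction t using Finset.induction_on with
  | empty => simpa using PosKernel.zero
  | insert a t ha ih =>
    simp only [Finset.sum_insert ha]
    exact (h a (by simp)).add (ih fun i hi => h i (by simp [hi]))

lemma PosKernel.twist {κ : X → X → ℂ} (h : PosKernel E κ) (g : X → ℂ) :
    PosKernel E (fun x y => g x * starRingEnd ℂ (g y) * κ x y) := by
  intro s v
  convert h s (fun x => starRingEnd ℂ (g x) • v x) using 4 with x hx y hy
  rw [inner_smul_left, inner_smul_right, Complex.conj_conj]
  ring

lemma PosKernel.limit {κ : ℕ → X → X → ℂ} {κ' : X → X → ℂ} (h : ∀ k, PosKernel E (κ k))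
    (hl : ∀ x y, Filter.Tendsto (fun k => κ k x y) Filter.atTop (𝓝 (κ' x y))) :
    PosKernel E κ' := by
  intro s v
  refine ge_of_tendsto' (x := Filter.atTop) ?_ fun k => h k s v
  refine (Complex.continuous_re.tendsto _).comp ?_
  exact tendsto_finsetSum _ fun x _ => tendsto_finsetSum _ fun y _ => (hl y x).mul_const _

lemma ballInner_eq (z w : UnitBall n) :
    ballInner z w = ⟪(w : EuclideanSpace ℂ (Fin n)), (z : EuclideanSpace ℂ (Fin n))⟫_ℂ := by
  simp [ballInner, PiLp.inner_apply]

lemma norm_ballInner_lt (z w : UnitBall n) : ‖ballInner z w‖ < 1 := by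
  have hz : ‖(z : EuclideanSpace ℂ (Fin n))‖ < 1 := mem_ball_zero_iff.mp z.2
  have hw : ‖(w : EuclideanSpace ℂ (Fin n))‖ < 1 := mem_ball_zero_iff.mp w.2
  rw [ballInner_eq]
  refine (norm_inner_le_norm _ _).trans_lt ?_
  nlinarith [norm_nonneg (z : EuclideanSpace ℂ (Fin n)), norm_nonneg (w : EuclideanSpace ℂ (Fin n))]

lemma conj_ballInner (z w : UnitBall n) : starRingEnd ℂ (ballInner z w) = ballInner w z := by
  simp [ballInner, mul_comm]

lemma one_sub_ballInner_ne_zero (z w : UnitBall n) : 1 - ballInner z w ≠ 0 := by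
  intro h
  have h1 := norm_ballInner_lt z w
  rw [← sub_eq_zero.mp h] at h1
  simp at h1

lemma PosKernel.inner_mul {κ : UnitBall n → UnitBall n → ℂ} (h : PosKernel E κ) :
    PosKernel E (fun z w => ballInner z w * κ z w) := by
  simp only [ballInner, Finset.sum_mul]
  exact PosKernel.sum _ fun i _ => h.twist fun z => (z : EuclideanSpace ℂ (Fin n)) i

lemma PosKernel.div_one_sub {κ : UnitBall n → UnitBall n → ℂ} (h : PosKernel E κ) :
    PosKernel E (fun z w => (1 - ballInner z w)⁻¹ * κ z w) := by
  refine PosKernel.limit (κ := fun N z w => ∑ k ∈ Finset.range N,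
    ballInner z w ^ k * κ z w) (fun N => PosKernel.sum _ fun k hk => ?_)
    fun z w => ?_
  · clear hk
    induction k with
    | zero => simpa using h
    | succ k ih => simpa only [pow_succ', mul_assoc] using ih.inner_mul
  · simp only [← Finset.sum_mul]
    exact ((hasSum_geometric_of_norm_lt_one (norm_ballInner_lt z w)).tendsto_sum_nat).mul_const _

lemma PosKernel.pow (m : ℕ) :
    PosKernel E (fun z w : UnitBall n =>
      ((1 - ballInner z w) ^ m)⁻¹) := by
  induction m with
  | zero => simpa using PosKernel.one
  | succ m ih => simpa only [pow_succ', mul_inv] using ih.div_one_sub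

end Positivity

section Space

variable {n m : ℕ} {E : Type*} [NormedAddCommGroup E] [InnerProductSpace ℂ E] [CompleteSpace E]

instance : Fact (ballKernel n m E).PosSemidef := by
  have key : (ballKernel n m E).IsHermitian ∧ ∀ vv : UnitBall n →₀ E,
      0 ≤ RCLike.re (vv.sum fun x w => vv.sum fun x' w' => ⟪ballKernel n m E x' x w, w'⟫_ℂ) := ?_
  · exact ⟨(RKHS.posSemidef_tfae.out 0 2).mpr key⟩
  refine ⟨?_, fun vv => ?_⟩
  · ext z w v
    refine ext_inner_right ℂ fun u => ?_
    simp [ballKernel, ContinuousLinearMap.star_eq_adjoint, ContinuousLinearMap.adjoint_inner_left,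
      inner_smul_left, conj_ballInner]
  · have := PosKernel.pow (E := E) (n := n) m vv.support vv
    convert this using 1
    rw [← Complex.conj_re]
    simp only [Finsupp.sum, map_sum (starRingEnd ℂ)]
    refine congrArg Complex.re (Finset.sum_congr rfl fun x _ => Finset.sum_congr rfl fun y _ => ?_)
    simp [ballKernel, mul_comm]

/-- The `E`-valued functional Hilbert space on the unit ball of `ℂ^n` with reproducing kernel
`K_m`. Its elements are coerced to functions on the ball. -/
abbrev BallSpace (n m : ℕ) (E : Type*) [NormedAddCommGroup E] [InnerProductSpace ℂ E]
    [CompleteSpace E] : Type _ :=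
  RKHS.OfKernel (ballKernel n m E)

lemma exists_mulCoord [NeZero m] (i : Fin n) :
    ∃ A : BallSpace n m E →L[ℂ] BallSpace n m E,
      ∀ f (z : UnitBall n), A f z = (z : EuclideanSpace ℂ (Fin n)) i • f z := by
  classical
  obtain ⟨k, rfl⟩ : ∃ k, m = k + 1 := ⟨m - 1, by have := NeZero.ne m; omega⟩
  let ker := RKHS.kerFun (BallSpace n (k + 1) E)
  let c : UnitBall n → ℂ := fun z => (z : EuclideanSpace ℂ (Fin n)) i
  let Φ : (UnitBall n →₀ E) →ₗ[ℂ] BallSpace n (k + 1) E :=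
    Finsupp.lsum ℂ fun z => (ker z).toLinearMap
  let Ψ : (UnitBall n →₀ E) →ₗ[ℂ] BallSpace n (k + 1) E :=
    Finsupp.lsum ℂ fun z => starRingEnd ℂ (c z) • (ker z).toLinearMap
  have hin : ∀ (z w : UnitBall n) (u v : E), ⟪ker z u, ker w v⟫_ℂ
      = starRingEnd ℂ ((1 - ballInner w z) ^ (k + 1))⁻¹ * ⟪u, v⟫_ℂ := by
    intro z w u v
    rw [← RKHS.kernel_inner, RKHS.OfKernel.kernel_ofKernel]
    simp [ballKernel, inner_smul_left]
  have hpos : PosKernel E (fun z w : UnitBall n =>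
      (1 - c z * starRingEnd ℂ (c w))
        * ((1 - ballInner z w) ^ (k + 1))⁻¹) := by
    have h1 := (PosKernel.pow (E := E) (n := n) k).add
      (PosKernel.sum (Finset.univ.erase i) fun j _ => (PosKernel.pow (E := E) (n := n) (k + 1)).twist
        fun z : UnitBall n => (z : EuclideanSpace ℂ (Fin n)) j)
    convert h1 using 3 with z w
    have h2 : (1 - c z * starRingEnd ℂ (c w)) = (1 - ballInner z w)
        + ∑ j ∈ Finset.univ.erase i, (z : EuclideanSpace ℂ (Fin n)) j
          * starRingEnd ℂ ((w : EuclideanSpace ℂ (Fin n)) j) := by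
      rw [ballInner, ← Finset.add_sum_erase _ _ (Finset.mem_univ i)]
      ring
    have h3 := one_sub_ballInner_ne_zero z w
    rw [h2, add_mul, Finset.sum_mul]
    congr 1
    rw [pow_succ']
    field_simp
  have hbound : ∀ f, ‖Ψ f‖ ≤ 1 * ‖Φ f‖ := by
    intro f
    rw [one_mul]
    refine le_of_sq_le_sq ?_ (norm_nonneg _)
    rw [← inner_self_eq_norm_sq (𝕜 := ℂ), ← inner_self_eq_norm_sq (𝕜 := ℂ), ← sub_nonneg]
    have h4 := hpos f.support f
    have h6 : ∀ g : UnitBall n →₀ E, Φ g = ∑ z ∈ g.support, ker z (g z) := fun g => by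
      simp [Φ, Finsupp.sum]
    have h7 : Ψ f = ∑ z ∈ f.support, starRingEnd ℂ (c z) • ker z (f z) := by
      simp [Ψ, Finsupp.sum]
    have h8 : ⟪Φ f, Φ f⟫_ℂ - ⟪Ψ f, Ψ f⟫_ℂ = ∑ x ∈ f.support, ∑ y ∈ f.support,
        (1 - c y * starRingEnd ℂ (c x)) * ((1 - ballInner y x) ^ (k + 1))⁻¹ * ⟪f y, f x⟫_ℂ := by
      rw [h6, h7]
      simp only [sum_inner, inner_sum]
      rw [← Finset.sum_sub_distrib]
      refine Finset.sum_congr rfl fun x _ => ?_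
      rw [← Finset.sum_sub_distrib]
      refine Finset.sum_congr rfl fun y _ => ?_
      rw [inner_smul_left, inner_smul_right, hin]
      simp only [map_inv₀, map_pow, map_sub, map_one, conj_ballInner, Complex.conj_conj]
      ring
    rw [← map_sub, h8]
    exact h4
  have hdense : DenseRange Φ := by
    have h9 : Submodule.span ℂ {ker z v | (z) (v)} ≤ LinearMap.range Φ := by
      rw [Submodule.span_le]
      rintro _ ⟨z, v, rfl⟩
      exact ⟨Finsupp.single z v, by simp [Φ]⟩
    have h10 := Submodule.topologicalClosure_mono h9
    rw [RKHS.kerFun_dense, top_le_iff] at h10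
    have h11 := (Submodule.dense_iff_topologicalClosure_eq_top).mpr h10
    rwa [LinearMap.coe_range] at h11
  refine ⟨(Ψ.extendOfNorm Φ)†, fun f z => ext_inner_left ℂ fun v => ?_⟩
  rw [← RKHS.kerFun_inner, ContinuousLinearMap.adjoint_inner_right]
  have h5 : RKHS.kerFun (BallSpace n (k + 1) E) z v = Φ (Finsupp.single z v) := by simp [Φ, ker]
  rw [h5, LinearMap.extendOfNorm_eq hdense ⟨1, hbound⟩]
  simp [Ψ, ker, c, inner_smul_left, inner_smul_right]

/-- The operator `M_{z_i}` of multiplication with the `i`-th coordinate function, a bounded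
operator if `m ≥ 1`. -/
def mulCoord (n m : ℕ) [NeZero m] (E : Type*) [NormedAddCommGroup E] [InnerProductSpace ℂ E]
    [CompleteSpace E] (i : Fin n) : BallSpace n m E →L[ℂ] BallSpace n m E :=
  (exists_mulCoord i).choose

lemma mulCoord_apply [NeZero m] (i : Fin n) (f : BallSpace n m E) (z : UnitBall n) :
    mulCoord n m E i f z = (z : EuclideanSpace ℂ (Fin n)) i • f z :=
  (exists_mulCoord i).choose_spec f z

end Space

/-! ### An equivalent scalar product -/

section Renormed

variable {H : Type*} [NormedAddCommGroup H] [InnerProductSpace ℂ H]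

/-- The space `H` equipped with the scalar product `(x, y) ↦ ⟨S x, y⟩`, where `S ≥ 1`. -/
@[nolint unusedArguments]
def Renormed (S : H →L[ℂ] H) (_ : 1 ≤ S) : Type _ := H

variable (S : H →L[ℂ] H) (hS : 1 ≤ S)

instance : AddCommGroup (Renormed S hS) := inferInstanceAs (AddCommGroup H)

instance : Module ℂ (Renormed S hS) := inferInstanceAs (Module ℂ H)

/-- The identity map `H → Renormed S`, as a linear equivalence. -/
def toRenormedₗ : H ≃ₗ[ℂ] Renormed S hS := LinearEquiv.refl ℂ H

variable {S} in
lemma norm_sq_le_inner (hS : 1 ≤ S) (x : H) : ‖x‖ ^ 2 ≤ RCLike.re ⟪S x, x⟫_ℂ := by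
  have h := ((ContinuousLinearMap.le_def _ _).mp hS).re_inner_nonneg_left x
  simp only [sub_apply, one_apply_eq_self, inner_sub_left, map_sub, inner_self_eq_norm_sq] at h
  linarith

/-- The scalar product `(x, y) ↦ ⟨S x, y⟩`. -/
abbrev renormedCore : InnerProductSpace.Core ℂ (Renormed S hS) where
  inner x y := ⟪S ((toRenormedₗ S hS).symm x), (toRenormedₗ S hS).symm y⟫_ℂ
  conj_inner_symm x y := by
    have h := ((ContinuousLinearMap.le_def _ _).mp hS).isSymmetric
      ((toRenormedₗ S hS).symm x) ((toRenormedₗ S hS).symm y)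
    rw [inner_conj_symm]
    simp [inner_sub_left, inner_sub_right] at h
    exact h.symm
  re_inner_nonneg x := (sq_nonneg _).trans (norm_sq_le_inner hS _)
  add_left x y z := by simp
  smul_left x y r := by simp [mul_comm]
  definite x hx := by
    have h := norm_sq_le_inner hS ((toRenormedₗ S hS).symm x)
    rw [hx] at h
    have h0 : ‖(toRenormedₗ S hS).symm x‖ = 0 := by
      have h1 : ‖(toRenormedₗ S hS).symm x‖ ^ 2 ≤ 0 := by simpa using h
      exact pow_eq_zero_iff two_ne_zero |>.mp (le_antisymm h1 (sq_nonneg _))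
    simpa using h0

instance : NormedAddCommGroup (Renormed S hS) :=
  @InnerProductSpace.Core.toNormedAddCommGroup ℂ _ _ _ _ (renormedCore S hS)

instance : InnerProductSpace ℂ (Renormed S hS) :=
  InnerProductSpace.ofCore (renormedCore S hS).toCore

lemma renormed_inner (x y : Renormed S hS) :
    ⟪x, y⟫_ℂ = ⟪S ((toRenormedₗ S hS).symm x), (toRenormedₗ S hS).symm y⟫_ℂ := rfl

lemma norm_toRenormedₗ_sq (x : H) : ‖toRenormedₗ S hS x‖ ^ 2 = RCLike.re ⟪S x, x⟫_ℂ := by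
  rw [← inner_self_eq_norm_sq (𝕜 := ℂ), renormed_inner]
  simp

/-- The identity map `H → Renormed S` is invertible and bounded in both directions. -/
def toRenormed : H ≃L[ℂ] Renormed S hS :=
  (toRenormedₗ S hS).toContinuousLinearEquivOfBounds (Real.sqrt ‖S‖) 1
    (fun x => by
      refine le_of_sq_le_sq ?_ (by positivity)
      rw [norm_toRenormedₗ_sq, mul_pow, Real.sq_sqrt (norm_nonneg _)]
      calc RCLike.re ⟪S x, x⟫_ℂ ≤ ‖S x‖ * ‖x‖ := re_inner_le_norm _ _
        _ ≤ ‖S‖ * ‖x‖ * ‖x‖ := by gcongr; exact S.le_opNorm x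
        _ = ‖S‖ * ‖x‖ ^ 2 := by ring)
    (fun x => by
      refine le_of_sq_le_sq ?_ (by positivity)
      obtain ⟨y, rfl⟩ := (toRenormedₗ S hS).surjective x
      rw [one_mul, norm_toRenormedₗ_sq, LinearEquiv.symm_apply_apply]
      exact norm_sq_le_inner hS y)

instance [CompleteSpace H] : CompleteSpace (Renormed S hS) :=
  ((toRenormed S hS).isUniformEmbedding.isUniformInducing.completeSpace_congr
    (toRenormed S hS).surjective).mp inferInstance

lemma inner_toRenormed (x y : H) : ⟪toRenormed S hS x, toRenormed S hS y⟫_ℂ = ⟪S x, y⟫_ℂ := rfl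

end Renormed

/-! ### Row contractions and hypercontractions -/

section Hyper

variable {H : Type*} [NormedAddCommGroup H] [InnerProductSpace ℂ H] [CompleteSpace H] {n : ℕ}

/-- The map `σ_T : X ↦ ∑ i, T_i X T_i⋆` on `L(H)`. -/
def sigma (T : Fin n → H →L[ℂ] H) : Module.End ℂ (H →L[ℂ] H) where
  toFun X := ∑ i, T i ∘L X ∘L (T i)†
  map_add' X Y := by
    simp [← Finset.sum_add_distrib, ContinuousLinearMap.comp_add, ContinuousLinearMap.add_comp]
  map_smul' c X := by
    simp [Finset.smul_sum, ContinuousLinearMap.smul_comp]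

/-- The `k`-th order defect operator `Δ_T^{(k)} = (1 - σ_T)^k (1_H)`. -/
def defectOrder (T : Fin n → H →L[ℂ] H) (k : ℕ) : H →L[ℂ] H := ((1 - sigma T) ^ k) 1

/-- A commuting tuple is an `m`-hypercontraction if its defect operators of the orders
`1, …, m` are positive. -/
structure IsHypercontraction (T : Fin n → H →L[ℂ] H) (m : ℕ) : Prop where
  comm : ∀ i j, Commute (T i) (T j)
  nonneg : ∀ k, 1 ≤ k → k ≤ m → 0 ≤ defectOrder T k

/-- A commuting tuple is a row contraction if `H^n → H`, `(x_i) ↦ ∑ i, T_i x_i`, is a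
contraction. -/
structure IsRowContraction (T : Fin n → H →L[ℂ] H) : Prop where
  comm : ∀ i j, Commute (T i) (T j)
  contraction : ‖row T‖ ≤ 1

/-- `T` is pure if `σ_T^k (1_H)` tends to `0` in the strong operator topology. -/
def IsPure (T : Fin n → H →L[ℂ] H) : Prop :=
  ∀ x : H, Filter.Tendsto (fun k : ℕ => ((sigma T) ^ k) 1 x) Filter.atTop (𝓝 0)

lemma row_apply {E F : Type*} [NormedAddCommGroup E] [InnerProductSpace ℂ E]
    [NormedAddCommGroup F] [InnerProductSpace ℂ F] (A : Fin n → E →L[ℂ] F)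
    (x : PiLp 2 (fun _ : Fin n => E)) : row A x = ∑ i, A i (x i) := by
  simp [row]

lemma row_adjoint_apply {E F : Type*} [NormedAddCommGroup E] [InnerProductSpace ℂ E]
    [CompleteSpace E] [NormedAddCommGroup F] [InnerProductSpace ℂ F] [CompleteSpace F]
    (A : Fin n → E →L[ℂ] F) (y : F) : ((row A)†) y = WithLp.toLp 2 fun i => ((A i)†) y := by
  refine ext_inner_right ℂ fun x => ?_
  rw [ContinuousLinearMap.adjoint_inner_left, row_apply, PiLp.inner_apply, inner_sum]
  simp [ContinuousLinearMap.adjoint_inner_left]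

lemma row_comp_adjoint {E F : Type*} [NormedAddCommGroup E] [InnerProductSpace ℂ E]
    [CompleteSpace E] [NormedAddCommGroup F] [InnerProductSpace ℂ F] [CompleteSpace F]
    (A : Fin n → E →L[ℂ] F) : row A ∘L (row A)† = ∑ i, A i ∘L (A i)† := by
  ext y
  simp [row_apply, row_adjoint_apply]

lemma defectOrder_zero (T : Fin n → H →L[ℂ] H) : defectOrder T 0 = 1 := by simp [defectOrder]

lemma defectOrder_one (T : Fin n → H →L[ℂ] H) : defectOrder T 1 = 1 - row T ∘L (row T)† := by
  rw [row_comp_adjoint]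
  simp [defectOrder, sigma, ContinuousLinearMap.one_def]

lemma IsRowContraction.isHypercontraction {T : Fin n → H →L[ℂ] H} (hT : IsRowContraction T) :
    IsHypercontraction T 1 where
  comm := hT.comm
  nonneg k h1 h2 := by
    obtain rfl : k = 1 := le_antisymm h2 h1
    have h := one_sub_nonneg (A := (row T)†) (by simpa using hT.contraction)
    rwa [ContinuousLinearMap.adjoint_adjoint, ← defectOrder_one] at h

/-- The operator `∑_{k < m} Δ_T^{(k)}`. -/
def defectSum (T : Fin n → H →L[ℂ] H) (m : ℕ) : H →L[ℂ] H :=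
  ∑ k ∈ Finset.range m, defectOrder T k

lemma sigma_defectSum (T : Fin n → H →L[ℂ] H) (m : ℕ) :
    sigma T (defectSum T m) = 1 - defectOrder T m := by
  have h := congrArg (fun L : Module.End ℂ (H →L[ℂ] H) => L 1) (mul_neg_geom_sum (1 - sigma T) m)
  simpa [defectSum, defectOrder] using h

variable {T : Fin n → H →L[ℂ] H} {m : ℕ} [NeZero m]

lemma IsHypercontraction.one_le_defectSum (hT : IsHypercontraction T m) : 1 ≤ defectSum T m := by
  obtain ⟨k, rfl⟩ : ∃ k, m = k + 1 := ⟨m - 1, by have := NeZero.ne m; omega⟩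
  rw [defectSum, Finset.sum_range_succ', defectOrder_zero]
  refine le_add_of_nonneg_left (Finset.sum_nonneg fun i hi => hT.nonneg _ (by omega) ?_)
  have := Finset.mem_range.mp hi
  omega

/-- The operator `(1_H - Z T⋆)^{-1}`; the inverse exists for `z` in the unit ball. -/
def ballResolvent (T : Fin n → H →L[ℂ] H) (z : UnitBall n) : H →L[ℂ] H :=
  Ring.inverse (1 - zRow H z ∘L (row T)†)

namespace IsHypercontraction

/-- The Hilbert space `H̃`: the space `H` with the scalar product
`(x, y) = ∑_{k < m} ⟨Δ_T^{(k)} x, y⟩`. -/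
abbrev Tilde (hT : IsHypercontraction T m) : Type _ :=
  Renormed (defectSum T m) hT.one_le_defectSum

/-- The identity map `I_m : H → H̃`. -/
def incl (hT : IsHypercontraction T m) : H ≃L[ℂ] hT.Tilde :=
  toRenormed (defectSum T m) hT.one_le_defectSum

/-- The row operator `T̃ : H̃^n → H` with components `T_i I_m⋆`. -/
def tildeRow (hT : IsHypercontraction T m) : PiLp 2 (fun _ : Fin n => hT.Tilde) →L[ℂ] H :=
  row fun i => T i ∘L (hT.incl : H →L[ℂ] hT.Tilde)†

/-- The operator `C = (Δ_T^{(m)})^{1/2}`. -/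
@[nolint unusedArguments]
def C (_ : IsHypercontraction T m) : H →L[ℂ] H := CFC.sqrt (defectOrder T m)

/-- The space `𝒟`, the closure of `C H`. -/
abbrev D (hT : IsHypercontraction T m) : Submodule ℂ H := closedRange hT.C

lemma incl_adjoint_apply (hT : IsHypercontraction T m) (x : H) :
    ((hT.incl : H →L[ℂ] hT.Tilde)†) (hT.incl x) = defectSum T m x := by
  refine ext_inner_right ℂ fun y => ?_
  rw [ContinuousLinearMap.adjoint_inner_left]
  exact inner_toRenormed _ _ x y

lemma tildeRow_comp_adjoint (hT : IsHypercontraction T m) :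
    hT.tildeRow ∘L hT.tildeRow† = 1 - defectOrder T m := by
  rw [tildeRow, row_comp_adjoint, ← sigma_defectSum]
  ext x
  simp [sigma, ContinuousLinearMap.adjoint_comp, incl_adjoint_apply]

lemma norm_tildeRow_le (hT : IsHypercontraction T m) : ‖hT.tildeRow‖ ≤ 1 := by
  rw [← LinearIsometryEquiv.norm_map ContinuousLinearMap.adjoint]
  refine ContinuousLinearMap.opNorm_le_bound _ zero_le_one fun x => ?_
  refine le_of_sq_le_sq ?_ (by positivity)
  have h := (ContinuousLinearMap.nonneg_iff_isPositive _).mp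
    (hT.nonneg m (Nat.one_le_iff_ne_zero.mpr (NeZero.ne m)) le_rfl)
  have h1 := h.re_inner_nonneg_left x
  have h2 := congrArg (fun A : H →L[ℂ] H => RCLike.re ⟪A x, x⟫_ℂ) hT.tildeRow_comp_adjoint
  simp only [ContinuousLinearMap.comp_apply, sub_apply, one_apply_eq_self, inner_sub_left, map_sub,
    inner_self_eq_norm_sq] at h2
  rw [← ContinuousLinearMap.adjoint_inner_right, inner_self_eq_norm_sq] at h2
  rw [one_mul]
  linarith

lemma defectSpace_tildeRow_adjoint (hT : IsHypercontraction T m) :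
    defectSpace (hT.tildeRow†) = hT.D := by
  rw [defectSpace, defectOp, ContinuousLinearMap.adjoint_adjoint, tildeRow_comp_adjoint,
    sub_sub_cancel]
  rfl

/-- The image of the map `j`, `(j x)(z) = C (1_H - Z T⋆)^{-m} x`, in `H_m(𝔹, 𝒟)`. -/
def rangeJ (hT : IsHypercontraction T m) : Submodule ℂ (BallSpace n m hT.D) where
  carrier := {f | ∃ x : H, ∀ z, (f z : H) = hT.C ((ballResolvent T z ^ m) x)}
  add_mem' := by
    rintro f g ⟨x, hx⟩ ⟨y, hy⟩
    exact ⟨x + y, fun z => by simp [hx, hy]⟩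
  zero_mem' := ⟨0, fun z => by simp⟩
  smul_mem' := by
    rintro c f ⟨x, hx⟩
    exact ⟨c • x, fun z => by simp [hx]⟩

/-- The subspace `M = H_m(𝔹, 𝒟) ⊖ Im j`. -/
def M (hT : IsHypercontraction T m) : Submodule ℂ (BallSpace n m hT.D) := hT.rangeJᗮ

/-- The wandering subspace `W(M) = M ⊖ ∑ i, M_{z_i} M`. -/
def wandering (hT : IsHypercontraction T m) : Submodule ℂ (BallSpace n m hT.D) :=
  hT.M ⊓ (⨆ i, hT.M.map (mulCoord n m hT.D i).toLinearMap)ᗮ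

/-- The space `𝒟̃` of all `y` in the defect space of `T̃` such that the tuple
`(⊕ j I_m⁻¹) D_{T̃} y` belongs to the range of the column operator `M_z⋆`. -/
def Dtilde (hT : IsHypercontraction T m) : Submodule ℂ (PiLp 2 (fun _ : Fin n => hT.Tilde)) where
  carrier := {y | y ∈ defectSpace hT.tildeRow ∧ ∃ f : BallSpace n m hT.D, ∀ i z,
    ((((mulCoord n m hT.D i)†) f) z : H)
      = hT.C ((ballResolvent T z ^ m) (hT.incl.symm (defectOp hT.tildeRow y i)))}
  add_mem' := by
    rintro x y ⟨hx, f, hf⟩ ⟨hy, g, hg⟩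
    exact ⟨add_mem hx hy, f + g, fun i z => by simp [hf, hg]⟩
  zero_mem' := ⟨zero_mem _, 0, fun i z => by simp⟩
  smul_mem' := by
    rintro c x ⟨hx, f, hf⟩
    exact ⟨Submodule.smul_mem _ _ hx, c • f, fun i z => by simp [hf]⟩

/-- The operator `W_T(z) : 𝒟̃ → 𝒟`,
`W_T(z) y = -T̃ y + C ∑_{1 ≤ k ≤ m} (1_H - Z T⋆)^{-k} I_m⁻¹ Z D_{T̃} y`. -/
def W (hT : IsHypercontraction T m) (z : UnitBall n) : hT.Dtilde →L[ℂ] hT.D :=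
  ((-hT.tildeRow + hT.C ∘L (∑ k ∈ Finset.Icc 1 m, ballResolvent T z ^ k)
      ∘L (hT.incl.symm : hT.Tilde →L[ℂ] H) ∘L zRow hT.Tilde z ∘L defectOp hT.tildeRow)
    ∘L hT.Dtilde.subtypeL).codRestrict hT.D fun y =>
      add_mem (neg_mem (hT.defectSpace_tildeRow_adjoint ▸
        contraction_maps_defectSpace hT.norm_tildeRow_le y.2.1)) (mem_closedRange _ _)

end IsHypercontraction

/-- The characteristic function `θ_T(z) : 𝒟_T → 𝒟_{T⋆}`,
`θ_T(z) = -T + D_{T⋆} (1_H - Z T⋆)^{-1} Z D_T`, of a row contraction. -/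
def IsRowContraction.theta (hT : IsRowContraction T) (z : UnitBall n) :
    defectSpace (row T) →L[ℂ] defectSpace ((row T)†) :=
  ((-row T + defectOp ((row T)†) ∘L ballResolvent T z ∘L zRow H z
      ∘L defectOp (row T)) ∘L (defectSpace (row T)).subtypeL).codRestrict _ fun y =>
    add_mem (neg_mem (contraction_maps_defectSpace hT.contraction y.2)) (mem_closedRange _ _)

end Hyper

end RowContraction

end

/-! For `m = 1` the operator `defectSum T 1` is the identity. Hence `H̃ = H` isometrically, `T̃`
becomes `T`, `C` becomes `D_{T⋆}`, and the sum in `W` has one term; the equality of `W_T` and `θ_T`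
on `𝒟̃` is then a matter of unfolding. The content is the unitary onto `W(M)`.

Two facts carry it. In the Drury-Arveson space `f = f(0) + ∑ M_{z_i} M_{z_i}⋆ f`, with `‖f‖² =
‖f(0)‖² + ∑ ‖M_{z_i}⋆ f‖²` (`kerFun_ballZero_add_sum`, `norm_sq_eq_add_sum`). And `j` is an isometry
with `j⋆ M_{z_i} = T_i j⋆` and `j⋆ c = D_{T⋆} c` for constants `c` (`exists_dilation`). Since `Im j`
is closed, `f ∈ W(M)` means that `j⋆ f = 0` and `M_{z_i}⋆ f = j x_i` for some `x ∈ H^n`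
(`mem_wandering_iff`). With `c = f(0)` this says `f(z) = c + D_{T⋆}(1 - ZT⋆)⁻¹ Z x` and `T x +
D_{T⋆} c = 0`.

The kernel of `(x, c) ↦ T x + D_{T⋆} c` on `H^n ⊕ 𝒟_{T⋆}` is `{(D_T y, -T y) : y ∈ 𝒟_T}`
(`exists_mem_defectSpace_of_add_eq_zero`), which rests on `T D_T = D_{T⋆} T` (`apply_defectOp`). So
`f = θ_T y` and `‖f‖² = ‖T y‖² + ‖D_T y‖² = ‖y‖²`. The condition defining `𝒟̃` is exactly that `j
D_T y` occurs as some `M_z⋆ f`.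

The isometry `j` is obtained as the adjoint of an operator `π` prescribed on kernel functions:
contractive as a limit of contractions, intertwining by differentiation of resolvents, coisometric
by purity. -/

noncomputable section

namespace RowContraction

/-! ### Intertwining relations from resolvent identities -/

section Resolvent

variable {F G : Type*} [NormedAddCommGroup F] [NormedSpace ℂ F] [CompleteSpace F]
  [NormedAddCommGroup G] [NormedSpace ℂ G] [CompleteSpace G]

lemma hasDerivAt_inverse_one_sub {B : ℂ → F →L[ℂ] F} {B' : F →L[ℂ] F} {t : ℂ}
    (hB : HasDerivAt B B' t) (hu : IsUnit (1 - B t)) :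
    HasDerivAt (fun s => Ring.inverse (1 - B s))
      (Ring.inverse (1 - B t) * B' * Ring.inverse (1 - B t)) t := by
  obtain ⟨u, hu⟩ := hu
  have h1 : HasDerivAt (fun s => 1 - B s) (-B') t := hB.const_sub 1
  have h2 := hasFDerivAt_ringInverse (𝕜 := ℂ) u
  rw [hu] at h2
  have h3 := h2.comp_hasDerivAt t h1
  rw [← hu, Ring.inverse_unit]
  refine h3.congr_deriv ?_
  simp

lemma commute_inverse_left {R : Type*} [Ring R] {A B : R} (h : Commute A B) (hA : IsUnit A) :
    Commute (Ring.inverse A) B := by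
  obtain ⟨u, rfl⟩ := hA
  rw [Ring.inverse_unit]
  exact h.units_inv_left

/-- Serves to integrate a squared resolvent: `(1 - tP)⁻²` has the primitive `t(1 - tP)⁻¹`, which
vanishes at `t = 0`. -/
lemma hasDerivAt_smul_inverse_one_sub {P : F →L[ℂ] F} {t : ℂ} (hu : IsUnit (1 - t • P)) :
    HasDerivAt (fun t : ℂ => t • Ring.inverse (1 - t • P))
      (Ring.inverse (1 - t • P) * Ring.inverse (1 - t • P)) t := by
  have d1 : HasDerivAt (fun s : ℂ => s • P) P t :=
    ((hasDerivAt_id' t).smul_const P).congr_deriv (one_smul _ _)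
  have d2 := hasDerivAt_inverse_one_sub d1 hu
  have h1 := Ring.mul_inverse_cancel _ hu
  generalize hQ : Ring.inverse (1 - t • P) = Q at h1 d2 ⊢
  have h2 : t • (P * Q) = Q - 1 := by
    rw [sub_mul, one_mul, smul_mul_assoc] at h1
    rw [← h1]
    abel
  refine ((hasDerivAt_id' t).smul d2).congr_deriv ?_
  rw [one_smul, mul_assoc, ← mul_smul_comm, h2, mul_sub, mul_one, hQ]
  abel

/-- If a bounded operator intertwines the resolvent functions of two commuting pairs, applied to
fixed vectors, then it intertwines the second components on the resolvent vectors. -/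
lemma intertwine_of_resolvent (π : F →L[ℂ] G) (e : F) (h : G) {P Q : F →L[ℂ] F}
    {R S : G →L[ℂ] G} (hPQ : Commute P Q) (hRS : Commute R S) {U : Set ℂ} (hU : IsOpen U)
    (hUc : IsPreconnected U) (h0 : 0 ∈ U) (h1 : 1 ∈ U) (hP : ∀ t ∈ U, IsUnit (1 - t • P))
    (hR : ∀ t ∈ U, IsUnit (1 - t • R))
    (hπ : ∀ t ∈ U, ∀ᶠ s in 𝓝 (0 : ℂ), π ((Ring.inverse (1 - (t • P + s • Q)) : F →L[ℂ] F) e)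
      = (Ring.inverse (1 - (t • R + s • S)) : G →L[ℂ] G) h) :
    π (Q (Ring.inverse (1 - P) e)) = S (Ring.inverse (1 - R) h) := by
  have hcP : ∀ t ∈ U, Commute (Ring.inverse (1 - t • P)) Q := fun t ht =>
    commute_inverse_left ((Commute.one_left _).sub_left (hPQ.smul_left t)) (hP t ht)
  have hcR : ∀ t ∈ U, Commute (Ring.inverse (1 - t • R)) S := fun t ht =>
    commute_inverse_left ((Commute.one_left _).sub_left (hRS.smul_left t)) (hR t ht)
  -- Differentiate the hypothesis in `s` at `0`; commutativity moves `Q` and `S` to the left and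
  -- leaves squared resolvents.
  have key1 : ∀ t ∈ U, π (Q ((Ring.inverse (1 - t • P)) (Ring.inverse (1 - t • P) e)))
      = S ((Ring.inverse (1 - t • R)) (Ring.inverse (1 - t • R) h)) := by
    intro t ht
    have d1 : HasDerivAt (fun s : ℂ => t • P + s • Q) Q 0 := by
      simpa using ((hasDerivAt_id (0 : ℂ)).smul_const Q).const_add (t • P)
    have d2 : HasDerivAt (fun s : ℂ => t • R + s • S) S 0 := by
      simpa using ((hasDerivAt_id (0 : ℂ)).smul_const S).const_add (t • R)
    have d3 := π.hasFDerivAt.comp_hasDerivAt (0 : ℂ)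
      ((hasDerivAt_inverse_one_sub d1 (by simpa using hP t ht)).clm_apply (hasDerivAt_const _ e))
    have d4 := (hasDerivAt_inverse_one_sub d2 (by simpa using hR t ht)).clm_apply
      (hasDerivAt_const _ h)
    have d5 := d3.unique (d4.congr_of_eventuallyEq (hπ t ht))
    simp only [zero_smul, add_zero, map_zero] at d5
    rw [(hcP t ht).eq, (hcR t ht).eq] at d5
    simpa using d5
  have key2 : ∀ t ∈ U, π ((Ring.inverse (1 - t • P) : F →L[ℂ] F) e)
      = (Ring.inverse (1 - t • R) : G →L[ℂ] G) h := fun t ht => by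
    simpa using (hπ t ht).self_of_nhds
  -- By `key1` the difference of the two primitives has derivative zero. It is therefore constant on
  -- `U`; it vanishes at `t = 0`, and its value at `t = 1` is the claim.
  have dg : ∀ t ∈ U, HasDerivAt (fun t : ℂ => π (Q ((t • Ring.inverse (1 - t • P)) e))
      - S ((t • Ring.inverse (1 - t • R)) h)) 0 t := by
    intro t ht
    have e1 := (π ∘L Q).hasFDerivAt.comp_hasDerivAt t
      ((hasDerivAt_smul_inverse_one_sub (hP t ht)).clm_apply (hasDerivAt_const _ e))
    have e2 := S.hasFDerivAt.comp_hasDerivAt t ((hasDerivAt_smul_inverse_one_sub (hR t ht)).clm_apply (hasDerivAt_const _ h))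
    have e3 := e1.sub e2
    refine e3.congr_deriv ?_
    simpa [sub_eq_zero] using key1 t ht
  have hconst := hU.is_const_of_deriv_eq_zero hUc
    (fun t ht => (dg t ht).differentiableAt.differentiableWithinAt)
    (fun t ht => (dg t ht).deriv) h1 h0
  simpa [sub_eq_zero] using hconst

end Resolvent

/-! ### Norms of linear combinations of the entries of a row contraction -/

section LinComb

variable {H : Type*} [NormedAddCommGroup H] [InnerProductSpace ℂ H] {n : ℕ}

/-- The vector `(a_i x)` in `H^n` has norm `‖a‖ ‖x‖`, and the row operator maps it to `∑ a_i T_i x`.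
-/
lemma norm_sum_smul_le {T : Fin n → H →L[ℂ] H} (hT : ‖row T‖ ≤ 1) (a : EuclideanSpace ℂ (Fin n)) :
    ‖∑ i, a i • T i‖ ≤ ‖a‖ := by
  refine ContinuousLinearMap.opNorm_le_bound _ (norm_nonneg _) fun x => ?_
  have h1 : (∑ i, a i • T i) x = row T (WithLp.toLp 2 fun i => a i • x) := by
    simp [row_apply]
  rw [h1]
  refine ((row T).le_of_opNorm_le hT _).trans_eq ?_
  rw [one_mul]
  refine (sq_eq_sq₀ (norm_nonneg _) (by positivity)).mp ?_
  rw [PiLp.norm_sq_eq_of_L2, mul_pow, EuclideanSpace.norm_sq_eq, Finset.sum_mul]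
  simp [norm_smul, mul_pow]


end LinComb

/-! ### The Drury-Arveson space -/

section DruryArveson

variable {n : ℕ} {K : Type*} [NormedAddCommGroup K] [InnerProductSpace ℂ K] [CompleteSpace K]

/-- The centre of the unit ball. -/
def ballZero (n : ℕ) : UnitBall n := ⟨0, by simp⟩

lemma ballZero_apply (i : Fin n) : (ballZero n : EuclideanSpace ℂ (Fin n)) i = 0 := rfl

lemma kerFun_ballSpace_apply {m : ℕ} (w z : UnitBall n) (u : K) :
    RKHS.kerFun (BallSpace n m K) w u z = ((1 - ballInner z w) ^ m)⁻¹ • u := by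
  rw [RKHS.kerFun_apply, RKHS.OfKernel.kernel_ofKernel]
  simp [ballKernel]

lemma kerFun_ballZero_apply {m : ℕ} (z : UnitBall n) (u : K) :
    RKHS.kerFun (BallSpace n m K) (ballZero n) u z = u := by
  rw [kerFun_ballSpace_apply]
  simp [ballInner, ballZero_apply]

lemma dense_span_kerFun (m : ℕ) :
    Dense (Submodule.span ℂ {RKHS.kerFun (BallSpace n m K) z v | (z) (v)} :
      Set (BallSpace n m K)) :=
  Submodule.dense_iff_topologicalClosure_eq_top.mpr (RKHS.kerFun_dense _)

lemma ballSpace_clm_ext {m : ℕ} {G : Type*} [NormedAddCommGroup G] [NormedSpace ℂ G]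
    {A B : BallSpace n m K →L[ℂ] G}
    (h : ∀ w u, A (RKHS.kerFun (BallSpace n m K) w u) = B (RKHS.kerFun (BallSpace n m K) w u)) :
    A = B := by
  refine ContinuousLinearMap.ext_on (dense_span_kerFun m) ?_
  rintro _ ⟨w, u, rfl⟩
  exact h w u

lemma mulCoord_adjoint_kerFun {m : ℕ} [NeZero m] (i : Fin n) (w : UnitBall n) (u : K) :
    ((mulCoord n m K i)†) (RKHS.kerFun (BallSpace n m K) w u)
      = starRingEnd ℂ ((w : EuclideanSpace ℂ (Fin n)) i) • RKHS.kerFun (BallSpace n m K) w u := by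
  refine ext_inner_right ℂ fun f => ?_
  rw [ContinuousLinearMap.adjoint_inner_left, RKHS.kerFun_inner, mulCoord_apply, inner_smul_left,
    inner_smul_right, RKHS.kerFun_inner, Complex.conj_conj]

lemma mulCoord_adjoint_kerFun_ballZero {m : ℕ} [NeZero m] (i : Fin n) (u : K) :
    ((mulCoord n m K i)†) (RKHS.kerFun (BallSpace n m K) (ballZero n) u) = 0 := by
  rw [mulCoord_adjoint_kerFun, ballZero_apply, map_zero, zero_smul]

lemma commute_mulCoord {m : ℕ} [NeZero m] (i j : Fin n) :
    Commute (mulCoord n m K i) (mulCoord n m K j) := by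
  ext f z
  simp [mulCoord_apply, smul_smul, mul_comm]

lemma sum_ballSpace_apply {m : ℕ} {ι : Type*} (s : Finset ι) (g : ι → BallSpace n m K)
    (z : UnitBall n) : (∑ i ∈ s, g i) z = ∑ i ∈ s, g i z := by
  have h := map_sum ((RKHS.kerFun (BallSpace n m K) z)†) g s
  simpa only [RKHS.adjoint_kerFun] using h

/-- On kernel functions this is `1 + ⟨z,w⟩ / (1 - ⟨z,w⟩) = 1 / (1 - ⟨z,w⟩)`, which is special to `m
= 1`; kernel functions span a dense subspace. -/
lemma kerFun_ballZero_add_sum (f : BallSpace n 1 K) :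
    RKHS.kerFun (BallSpace n 1 K) (ballZero n) (f (ballZero n))
      + ∑ i, mulCoord n 1 K i (((mulCoord n 1 K i)†) f) = f := by
  have h : RKHS.kerFun (BallSpace n 1 K) (ballZero n)
      ∘L (RKHS.kerFun (BallSpace n 1 K) (ballZero n))†
      + ∑ i, mulCoord n 1 K i ∘L (mulCoord n 1 K i)† = 1 := by
    refine ballSpace_clm_ext fun w u => ?_
    ext z
    have h1 := one_sub_ballInner_ne_zero z w
    have h2 : ∀ i, (mulCoord n 1 K i (((mulCoord n 1 K i)†)
        (RKHS.kerFun (BallSpace n 1 K) w u))) z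
        = ((z : EuclideanSpace ℂ (Fin n)) i * starRingEnd ℂ ((w : EuclideanSpace ℂ (Fin n)) i)
          * (1 - ballInner z w)⁻¹) • u := fun i => by
      rw [mulCoord_adjoint_kerFun, mulCoord_apply, RKHS.coe_smul, Pi.smul_apply,
        kerFun_ballSpace_apply, pow_one, smul_smul, smul_smul]
    simp only [add_apply, sum_apply, ContinuousLinearMap.comp_apply, RKHS.adjoint_kerFun,
      RKHS.coe_add, Pi.add_apply, sum_ballSpace_apply, h2, one_apply_eq_self, kerFun_ballZero_apply]
    rw [← Finset.sum_smul, ← Finset.sum_mul, ← ballInner, kerFun_ballSpace_apply,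
      kerFun_ballSpace_apply, ← add_smul]
    have h4 : ballInner (ballZero n) w = 0 := by simp [ballInner, ballZero_apply]
    rw [h4]
    congr 1
    field_simp
    ring
  simpa using congrArg (fun A : BallSpace n 1 K →L[ℂ] BallSpace n 1 K => A f) h

lemma norm_sq_eq_add_sum (f : BallSpace n 1 K) :
    ‖f‖ ^ 2 = ‖f (ballZero n)‖ ^ 2 + ∑ i, ‖((mulCoord n 1 K i)†) f‖ ^ 2 := by
  have h := congrArg (fun g => RCLike.re ⟪g, f⟫_ℂ) (kerFun_ballZero_add_sum f)
  simp only [inner_add_left, sum_inner, RKHS.kerFun_inner, map_add, map_sum] at h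
  simp only [← ContinuousLinearMap.adjoint_inner_right (mulCoord n 1 K _),
    inner_self_eq_norm_sq] at h
  exact h.symm

lemma norm_row_mulCoord_le : ‖row (mulCoord n 1 K)‖ ≤ 1 := by
  rw [← LinearIsometryEquiv.norm_map ContinuousLinearMap.adjoint]
  refine ContinuousLinearMap.opNorm_le_bound _ zero_le_one fun f => ?_
  refine le_of_sq_le_sq ?_ (by positivity)
  rw [row_adjoint_apply, PiLp.norm_sq_eq_of_L2, one_mul, norm_sq_eq_add_sum f]
  exact le_add_of_nonneg_left (sq_nonneg _)

/-- The coordinatewise complex conjugate of a point. -/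
def conjVec (z : EuclideanSpace ℂ (Fin n)) : EuclideanSpace ℂ (Fin n) :=
  WithLp.toLp 2 fun i => starRingEnd ℂ (z i)

lemma norm_conjVec (z : EuclideanSpace ℂ (Fin n)) : ‖conjVec z‖ = ‖z‖ := by
  simp [EuclideanSpace.norm_eq, conjVec]

lemma isUnit_one_sub_sum_conj {H : Type*} [NormedAddCommGroup H] [InnerProductSpace ℂ H]
    [CompleteSpace H] {T : Fin n → H →L[ℂ] H} (hT : ‖row T‖ ≤ 1) (z : UnitBall n) :
    IsUnit (1 - ∑ i, starRingEnd ℂ ((z : EuclideanSpace ℂ (Fin n)) i) • T i) := by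
  refine isUnit_one_sub_of_norm_lt_one ?_
  refine (norm_sum_smul_le hT (conjVec z)).trans_lt ?_
  rw [norm_conjVec]
  exact mem_ball_zero_iff.mp z.2

/-- Writes a kernel function as a resolvent applied to a constant, the form needed for
`intertwine_of_resolvent`. It follows from `kerFun_ballZero_add_sum`, since `k_w u` is an
eigenvector of each `M_{z_i}⋆` with eigenvalue `conj w_i`. -/
lemma inverse_one_sub_mulCoord_kerFun (w : UnitBall n) (u : K) :
    (Ring.inverse (1 - ∑ i, starRingEnd ℂ ((w : EuclideanSpace ℂ (Fin n)) i) • mulCoord n 1 K i) :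
      BallSpace n 1 K →L[ℂ] BallSpace n 1 K) (RKHS.kerFun (BallSpace n 1 K) (ballZero n) u)
      = RKHS.kerFun (BallSpace n 1 K) w u := by
  have h1 := kerFun_ballZero_add_sum (RKHS.kerFun (BallSpace n 1 K) w u)
  have h2 : RKHS.kerFun (BallSpace n 1 K) w u (ballZero n) = u := by
    rw [kerFun_ballSpace_apply]
    simp [ballInner, ballZero_apply]
  simp only [h2, mulCoord_adjoint_kerFun] at h1
  have h3 : RKHS.kerFun (BallSpace n 1 K) (ballZero n) u
      = (1 - ∑ i, starRingEnd ℂ ((w : EuclideanSpace ℂ (Fin n)) i) • mulCoord n 1 K i)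
        (RKHS.kerFun (BallSpace n 1 K) w u) := by
    simpa [eq_sub_iff_add_eq, sum_apply] using h1
  rw [h3, ← mul_apply_eq_comp,
    Ring.inverse_mul_cancel _ (isUnit_one_sub_sum_conj norm_row_mulCoord_le w)]
  rfl

end DruryArveson

/-! ### The canonical dilation and its adjoint -/

section Poisson

variable {n : ℕ} {H K : Type*} [NormedAddCommGroup H] [InnerProductSpace ℂ H] [CompleteSpace H]
  [NormedAddCommGroup K] [InnerProductSpace ℂ K] [CompleteSpace K]
  {T : Fin n → H →L[ℂ] H} {C : H →L[ℂ] K}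

lemma norm_sq_add_norm_adjoint_sq (hC : C† ∘L C + row T ∘L (row T)† = 1) (x : H) :
    ‖C x‖ ^ 2 + ‖((row T)†) x‖ ^ 2 = ‖x‖ ^ 2 := by
  have h := congrArg (fun A : H →L[ℂ] H => RCLike.re ⟪A x, x⟫_ℂ) hC
  simp only [add_apply, ContinuousLinearMap.comp_apply, inner_add_left, map_add,
    ContinuousLinearMap.adjoint_inner_left, one_apply_eq_self, inner_self_eq_norm_sq] at h
  rwa [← ContinuousLinearMap.adjoint_inner_right, inner_self_eq_norm_sq] at h

lemma norm_adjoint_row_sq (x : H) : ‖((row T)†) x‖ ^ 2 = ∑ i, ‖((T i)†) x‖ ^ 2 := by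
  rw [row_adjoint_apply, PiLp.norm_sq_eq_of_L2]

lemma norm_row_le_one (hC : C† ∘L C + row T ∘L (row T)† = 1) : ‖row T‖ ≤ 1 := by
  rw [← LinearIsometryEquiv.norm_map ContinuousLinearMap.adjoint]
  refine ContinuousLinearMap.opNorm_le_bound _ zero_le_one fun x => ?_
  refine le_of_sq_le_sq ?_ (by positivity)
  rw [one_mul, ← norm_sq_add_norm_adjoint_sq hC x]
  exact le_add_of_nonneg_left (sq_nonneg _)

/-- The map `(c, x) ↦ C⋆ c + T x` is the adjoint of the isometry `y ↦ (C y, T⋆ y)`, hence a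
contraction. -/
lemma norm_sq_adjoint_add_row_le (hC : C† ∘L C + row T ∘L (row T)† = 1) (c : K)
    (x : PiLp 2 (fun _ : Fin n => H)) : ‖(C†) c + row T x‖ ^ 2 ≤ ‖c‖ ^ 2 + ‖x‖ ^ 2 := by
  set y := (C†) c + row T x with hy
  have h1 : ‖y‖ ^ 2 = RCLike.re ⟪c, C y⟫_ℂ + RCLike.re ⟪x, ((row T)†) y⟫_ℂ := by
    rw [ContinuousLinearMap.adjoint_inner_right, ← ContinuousLinearMap.adjoint_inner_left,
      ← map_add, ← inner_add_left, ← hy, inner_self_eq_norm_sq]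
  have h2 := re_inner_le_norm (𝕜 := ℂ) c (C y)
  have h3 := re_inner_le_norm (𝕜 := ℂ) x (((row T)†) y)
  have h4 := norm_sq_add_norm_adjoint_sq hC y
  -- Bounding both products by arithmetic-geometric means gives `‖y‖² ≤ (‖c‖² + ‖x‖² + ‖y‖²) / 2`.
  nlinarith [sq_nonneg (‖c‖ - ‖C y‖), sq_nonneg (‖x‖ - ‖((row T)†) y‖)]

/-- The partial sums of the adjoint of the canonical dilation. -/
def dilationApprox (T : Fin n → H →L[ℂ] H) (C : H →L[ℂ] K) : ℕ → BallSpace n 1 K →L[ℂ] H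
  | 0 => 0
  | N + 1 => C† ∘L (RKHS.kerFun (BallSpace n 1 K) (ballZero n))†
      + ∑ i, T i ∘L dilationApprox T C N ∘L (mulCoord n 1 K i)†

lemma dilationApprox_succ_apply (N : ℕ) (f : BallSpace n 1 K) :
    dilationApprox T C (N + 1) f = (C†) (f (ballZero n))
      + row T (WithLp.toLp 2 fun i => dilationApprox T C N (((mulCoord n 1 K i)†) f)) := by
  simp [dilationApprox, row_apply, sum_apply]

lemma norm_dilationApprox_apply_le (hC : C† ∘L C + row T ∘L (row T)† = 1) (N : ℕ)
    (f : BallSpace n 1 K) : ‖dilationApprox T C N f‖ ≤ ‖f‖ := by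
  induction N generalizing f with
  | zero => simp [dilationApprox]
  | succ N ih =>
    refine le_of_sq_le_sq ?_ (norm_nonneg _)
    rw [dilationApprox_succ_apply, norm_sq_eq_add_sum f]
    refine (norm_sq_adjoint_add_row_le hC _ _).trans ?_
    rw [PiLp.norm_sq_eq_of_L2]
    gcongr with i
    exact ih _

/-- On a kernel function the recursion produces the partial sums of the Neumann series of the
resolvent, because `M_{z_i}⋆` acts there as the scalar `conj z_i`. -/
lemma dilationApprox_kerFun (N : ℕ) (z : UnitBall n) (u : K) :
    dilationApprox T C N (RKHS.kerFun (BallSpace n 1 K) z u)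
      = (∑ k ∈ Finset.range N,
        (∑ i, starRingEnd ℂ ((z : EuclideanSpace ℂ (Fin n)) i) • T i) ^ k) ((C†) u) := by
  induction N with
  | zero => simp [dilationApprox]
  | succ N ih =>
    have h2 : RKHS.kerFun (BallSpace n 1 K) z u (ballZero n) = u := by
      rw [kerFun_ballSpace_apply]
      simp [ballInner, ballZero_apply]
    rw [dilationApprox_succ_apply, h2, Finset.sum_range_succ']
    simp only [pow_succ', ← Finset.mul_sum, pow_zero, add_apply, mul_apply_eq_comp, ← ih,
      mulCoord_adjoint_kerFun, map_smul, row_apply, sum_apply, smul_apply, one_apply_eq_self]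
    rw [add_comm]

lemma tendsto_dilationApprox_kerFun (hC : C† ∘L C + row T ∘L (row T)† = 1) (z : UnitBall n)
    (u : K) :
    Filter.Tendsto (fun N => dilationApprox T C N (RKHS.kerFun (BallSpace n 1 K) z u))
      Filter.atTop (𝓝 ((Ring.inverse
        (1 - ∑ i, starRingEnd ℂ ((z : EuclideanSpace ℂ (Fin n)) i) • T i) : H →L[ℂ] H)
          ((C†) u))) := by
  have h1 : ‖∑ i, starRingEnd ℂ ((z : EuclideanSpace ℂ (Fin n)) i) • T i‖ < 1 := by
    refine (norm_sum_smul_le (norm_row_le_one hC) (conjVec z)).trans_lt ?_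
    rw [norm_conjVec]
    exact mem_ball_zero_iff.mp z.2
  have h2 := (summable_geometric_of_norm_lt_one h1).hasSum.tendsto_sum_nat
  have h3 : Ring.inverse (1 - ∑ i, starRingEnd ℂ ((z : EuclideanSpace ℂ (Fin n)) i) • T i)
      = ∑' k : ℕ, (∑ i, starRingEnd ℂ ((z : EuclideanSpace ℂ (Fin n)) i) • T i) ^ k :=
    NormedRing.inverse_one_sub _ h1
  simp only [dilationApprox_kerFun, h3]
  exact ((ContinuousLinearMap.apply ℂ H ((C†) u)).continuous.tendsto _).comp h2

/-- The adjoint of the canonical dilation of a row contraction `T` to the Drury-Arveson space. -/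
lemma exists_dilationAdjoint (hC : C† ∘L C + row T ∘L (row T)† = 1) :
    ∃ π : BallSpace n 1 K →L[ℂ] H, ‖π‖ ≤ 1 ∧ ∀ (z : UnitBall n) (u : K),
      π (RKHS.kerFun (BallSpace n 1 K) z u) = (Ring.inverse
        (1 - ∑ i, starRingEnd ℂ ((z : EuclideanSpace ℂ (Fin n)) i) • T i) : H →L[ℂ] H)
          ((C†) u) := by
  classical
  let ker := RKHS.kerFun (BallSpace n 1 K)
  let Φ : (UnitBall n →₀ K) →ₗ[ℂ] BallSpace n 1 K := Finsupp.lsum ℂ fun z => (ker z).toLinearMap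
  let R : UnitBall n → H →L[ℂ] H := fun z =>
    Ring.inverse (1 - ∑ i, starRingEnd ℂ ((z : EuclideanSpace ℂ (Fin n)) i) • T i)
  let Ψ : (UnitBall n →₀ K) →ₗ[ℂ] H := Finsupp.lsum ℂ fun z => (R z ∘L C†).toLinearMap
  -- This one estimate makes the prescription on kernel functions both well defined and contractive:
  -- on finite combinations `Ψ` is a pointwise limit of the contractions `dilationApprox T C N`.
  have hbound : ∀ f, ‖Ψ f‖ ≤ 1 * ‖Φ f‖ := by
    intro f
    rw [one_mul]
    have h1 : Filter.Tendsto (fun N => dilationApprox T C N (Φ f)) Filter.atTop (𝓝 (Ψ f)) := by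
      have h2 : Φ f = ∑ z ∈ f.support, ker z (f z) := by simp [Φ, Finsupp.sum]
      have h3 : Ψ f = ∑ z ∈ f.support, R z ((C†) (f z)) := by simp [Ψ, Finsupp.sum]
      simp only [h2, h3, map_sum]
      exact tendsto_finsetSum _ fun z _ => tendsto_dilationApprox_kerFun hC z (f z)
    exact le_of_tendsto h1.norm
      (Filter.Eventually.of_forall fun N => norm_dilationApprox_apply_le hC N _)
  have hdense : DenseRange Φ := by
    refine (dense_span_kerFun (n := n) (K := K) 1).mono ?_
    have h : Submodule.span ℂ {ker z v | (z) (v)} ≤ LinearMap.range Φ := by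
      rw [Submodule.span_le]
      rintro _ ⟨z, v, rfl⟩
      exact ⟨Finsupp.single z v, by simp [Φ]⟩
    exact h
  refine ⟨Ψ.extendOfNorm Φ, LinearMap.opNorm_extendOfNorm_le hdense zero_le_one hbound, fun z u => ?_⟩
  have h5 : RKHS.kerFun (BallSpace n 1 K) z u = Φ (Finsupp.single z u) := by simp [Φ, ker]
  rw [h5, LinearMap.extendOfNorm_eq hdense ⟨1, hbound⟩]
  simp [Ψ, R]

/-- Perturbing in the direction `A_j` amounts to moving the point `z` to `conj t • z + conj s •
e_j`. While this point lies in the ball, the formula for `π` on its kernel functions supplies the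
resolvent identity required by `intertwine_of_resolvent`. -/
lemma smul_sum_conj_add_smul {G : Type*} [NormedAddCommGroup G] [InnerProductSpace ℂ G]
    (A : Fin n → G →L[ℂ] G) (z : EuclideanSpace ℂ (Fin n)) (j : Fin n) (t s : ℂ) :
    t • (∑ i, starRingEnd ℂ (z i) • A i) + s • A j
      = ∑ i, starRingEnd ℂ ((starRingEnd ℂ t • z
          + starRingEnd ℂ s • EuclideanSpace.single j 1 : EuclideanSpace ℂ (Fin n)) i) • A i := by
  have h : ∀ i, starRingEnd ℂ ((starRingEnd ℂ t • z
          + starRingEnd ℂ s • EuclideanSpace.single j 1 : EuclideanSpace ℂ (Fin n)) i) • A i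
      = t • starRingEnd ℂ (z i) • A i + if i = j then s • A i else 0 := by
    intro i
    by_cases hij : i = j <;> simp [hij, add_smul, smul_smul]
  simp only [h, Finset.sum_add_distrib, Finset.smul_sum]
  simp

lemma commute_sum_conj {G : Type*} [NormedAddCommGroup G] [InnerProductSpace ℂ G]
    {A : Fin n → G →L[ℂ] G} (hA : ∀ i j, Commute (A i) (A j)) (z : EuclideanSpace ℂ (Fin n))
    (j : Fin n) : Commute (∑ i, starRingEnd ℂ (z i) • A i) (A j) :=
  Commute.sum_left _ _ _ fun i _ => (hA i j).smul_left _

/-- The adjoint of the canonical dilation intertwines the coordinate multiplications with `T`. -/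
lemma dilationAdjoint_mulCoord (hC : C† ∘L C + row T ∘L (row T)† = 1)
    (hcomm : ∀ i j, Commute (T i) (T j)) {π : BallSpace n 1 K →L[ℂ] H}
    (hπ : ∀ (z : UnitBall n) (u : K),
      π (RKHS.kerFun (BallSpace n 1 K) z u) = (Ring.inverse
        (1 - ∑ i, starRingEnd ℂ ((z : EuclideanSpace ℂ (Fin n)) i) • T i) : H →L[ℂ] H) ((C†) u))
    (j : Fin n) (f : BallSpace n 1 K) : π (mulCoord n 1 K j f) = T j (π f) := by
  suffices h : π ∘L mulCoord n 1 K j = T j ∘L π from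
    congrArg (fun A : BallSpace n 1 K →L[ℂ] H => A f) h
  refine ballSpace_clm_ext fun z u => ?_
  rw [ContinuousLinearMap.comp_apply, ContinuousLinearMap.comp_apply, hπ,
    ← inverse_one_sub_mulCoord_kerFun]
  have hT := norm_row_le_one hC
  -- The parameters for which `conj t • z` stays in the ball: an open convex set that contains `0`,
  -- and contains `1` because `z` is in the ball.
  let U : Set ℂ := {t | ‖starRingEnd ℂ t • (z : EuclideanSpace ℂ (Fin n))‖ < 1}
  have hUo : IsOpen U := isOpen_lt (by fun_prop) continuous_const
  have hUc : IsPreconnected U := by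
    refine Convex.isPreconnected ?_
    intro s hs t ht a b ha hb hab
    simp only [U, Set.mem_ofPred_eq, norm_smul, RCLike.norm_conj] at hs ht ⊢
    have h1 : ‖a • s + b • t‖ ≤ a * ‖s‖ + b * ‖t‖ := by
      refine (norm_add_le _ _).trans_eq ?_
      rw [norm_smul, norm_smul, Real.norm_of_nonneg ha, Real.norm_of_nonneg hb]
    have h2 := norm_nonneg (z : EuclideanSpace ℂ (Fin n))
    calc ‖a • s + b • t‖ * ‖(z : EuclideanSpace ℂ (Fin n))‖
        ≤ (a * ‖s‖ + b * ‖t‖) * ‖(z : EuclideanSpace ℂ (Fin n))‖ := by gcongr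
      _ = a * (‖s‖ * ‖(z : EuclideanSpace ℂ (Fin n))‖)
          + b * (‖t‖ * ‖(z : EuclideanSpace ℂ (Fin n))‖) := by ring
      _ < 1 := by
        have := (convex_Iio (𝕜 := ℝ) (1 : ℝ)) hs ht ha hb hab
        simpa using this
  have hz : ‖(z : EuclideanSpace ℂ (Fin n))‖ < 1 := mem_ball_zero_iff.mp z.2
  refine intertwine_of_resolvent (U := U) π _ _ (commute_sum_conj commute_mulCoord _ j)
    (commute_sum_conj hcomm _ j) hUo hUc
    (by simp [U]) (by simpa [U] using hz) ?_ ?_ ?_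
  · intro t ht
    have h := isUnit_one_sub_sum_conj (norm_row_mulCoord_le (n := n) (K := K))
      ⟨starRingEnd ℂ t • (z : EuclideanSpace ℂ (Fin n)), mem_ball_zero_iff.mpr ht⟩
    simpa [Finset.smul_sum, smul_smul] using h
  · intro t ht
    have h := isUnit_one_sub_sum_conj hT
      ⟨starRingEnd ℂ t • (z : EuclideanSpace ℂ (Fin n)), mem_ball_zero_iff.mpr ht⟩
    simpa [Finset.smul_sum, smul_smul] using h
  · intro t ht
    have h1 : ∀ᶠ s in 𝓝 (0 : ℂ), ‖starRingEnd ℂ t • (z : EuclideanSpace ℂ (Fin n))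
          + starRingEnd ℂ s • EuclideanSpace.single j 1‖ < 1 := by
      have hc : Continuous fun s : ℂ => ‖starRingEnd ℂ t • (z : EuclideanSpace ℂ (Fin n))
          + starRingEnd ℂ s • EuclideanSpace.single j 1‖ := by
        fun_prop
      refine hc.continuousAt.eventually_lt continuousAt_const ?_
      simpa using! ht
    filter_upwards [h1] with s hs
    rw [smul_sum_conj_add_smul, smul_sum_conj_add_smul]
    have h2 := inverse_one_sub_mulCoord_kerFun (K := K) ⟨_, mem_ball_zero_iff.mpr hs⟩ u
    have h3 := hπ ⟨_, mem_ball_zero_iff.mpr hs⟩ u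
    rw [← h2] at h3
    exact h3

/-- The canonical dilation of a pure row contraction is isometric. -/
lemma norm_adjoint_dilationAdjoint (hC : C† ∘L C + row T ∘L (row T)† = 1)
    (hpure : IsPure T) {π : BallSpace n 1 K →L[ℂ] H} (hπ1 : ‖π‖ ≤ 1)
    (h0 : ∀ u : K, π (RKHS.kerFun (BallSpace n 1 K) (ballZero n) u) = (C†) u)
    (hπ : ∀ i f, π (mulCoord n 1 K i f) = T i (π f)) (x : H) : ‖(π†) x‖ = ‖x‖ := by
  have e1 : ∀ x, ((π†) x) (ballZero n) = C x := by
    intro x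
    refine ext_inner_left ℂ fun u => ?_
    rw [← RKHS.kerFun_inner, ContinuousLinearMap.adjoint_inner_right, h0,
      ContinuousLinearMap.adjoint_inner_left]
  have e2 : ∀ i x, ((mulCoord n 1 K i)†) ((π†) x) = (π†) (((T i)†) x) := by
    intro i x
    refine ext_inner_left ℂ fun f => ?_
    rw [ContinuousLinearMap.adjoint_inner_right, ContinuousLinearMap.adjoint_inner_right, hπ,
      ContinuousLinearMap.adjoint_inner_right, ContinuousLinearMap.adjoint_inner_right]
  -- The isometry defect `q(x) = ‖x‖² - ‖π⋆ x‖²` satisfies `q(x) = ∑ q(T_i⋆ x)`. Iterating gives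
  -- `q(x) ≤ ⟨σ_T^N(1) x, x⟩`, which tends to `0` by purity.
  have e3 : ∀ x, ‖x‖ ^ 2 - ‖(π†) x‖ ^ 2
      = ∑ i, (‖((T i)†) x‖ ^ 2 - ‖(π†) (((T i)†) x)‖ ^ 2) := by
    intro x
    rw [norm_sq_eq_add_sum ((π†) x), ← norm_sq_add_norm_adjoint_sq hC x, norm_adjoint_row_sq, e1]
    simp only [e2, Finset.sum_sub_distrib]
    ring
  have hsig : ∀ N x, ((sigma T) ^ (N + 1)) 1 x = ∑ i, T i (((sigma T) ^ N) 1 (((T i)†) x)) := by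
    intro N x
    rw [pow_succ']
    simp [sigma, sum_apply]
  have hle : ∀ N x, ‖x‖ ^ 2 - ‖(π†) x‖ ^ 2 ≤ RCLike.re ⟪((sigma T) ^ N) 1 x, x⟫_ℂ := by
    intro N
    induction N with
    | zero => intro x; rw [pow_zero]; simp only [Module.End.one_apply, one_apply_eq_self, inner_self_eq_norm_sq]; linarith [sq_nonneg ‖(π†) x‖]
    | succ N ih =>
      intro x
      rw [e3, hsig, sum_inner, map_sum]
      refine Finset.sum_le_sum fun i _ => ?_
      rw [← ContinuousLinearMap.adjoint_inner_right]
      exact ih _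
  have hlim : Filter.Tendsto (fun N => RCLike.re ⟪((sigma T) ^ N) 1 x, x⟫_ℂ) Filter.atTop
      (𝓝 0) := by
    have h := (hpure x).inner (tendsto_const_nhds (x := x)) (𝕜 := ℂ)
    rw [inner_zero_left] at h
    simpa only [map_zero] using! (RCLike.continuous_re.tendsto _).comp h
  have h1 : ‖x‖ ^ 2 - ‖(π†) x‖ ^ 2 ≤ 0 := ge_of_tendsto' hlim fun N => hle N x
  have h2 : ‖(π†) x‖ ≤ ‖x‖ := by
    have h3 := (π†).le_of_opNorm_le (by simpa using hπ1) x
    rwa [one_mul] at h3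
  refine le_antisymm h2 (le_of_sq_le_sq ?_ (norm_nonneg _))
  linarith

end Poisson

/-! ### Defect operators of a contraction and of its adjoint -/

section DefectIntertwining

variable {E F : Type*} [NormedAddCommGroup E] [InnerProductSpace ℂ E] [CompleteSpace E]
  [NormedAddCommGroup F] [InnerProductSpace ℂ F] [CompleteSpace F]

/-- The product `Q X X⋆ = -X P X⋆` is self-adjoint, so `Q` and `X X⋆` commute. As a product of
commuting positive operators it is positive, yet it is visibly negative; hence it vanishes, and with
it `X⋆ Q`. -/
lemma eq_zero_of_comp_eq_neg_comp {P : E →L[ℂ] E} {Q : F →L[ℂ] F} (hP : 0 ≤ P) (hQ : 0 ≤ Q)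
    {X : E →L[ℂ] F} (hX : Q ∘L X = -(X ∘L P)) : Q ∘L X = 0 := by
  have hP' := (ContinuousLinearMap.nonneg_iff_isPositive P).mp hP
  have hXX : 0 ≤ X ∘L X† :=
    (ContinuousLinearMap.nonneg_iff_isPositive _).mpr
      (ContinuousLinearMap.isPositive_self_comp_adjoint X)
  have hXPX : 0 ≤ X ∘L P ∘L X† :=
    (ContinuousLinearMap.nonneg_iff_isPositive _).mpr (hP'.conj_adjoint X)
  have h1 : Q * (X ∘L X†) = -(X ∘L P ∘L X†) := by
    rw [ContinuousLinearMap.mul_def, ← ContinuousLinearMap.comp_assoc, hX,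
      ContinuousLinearMap.neg_comp, ContinuousLinearMap.comp_assoc]
  have hc : Commute Q (X ∘L X†) := by
    refine (IsSelfAdjoint.commute_iff hQ.isSelfAdjoint hXX.isSelfAdjoint).mpr ?_
    rw [h1]
    exact hXPX.isSelfAdjoint.neg
  have h2 : 0 ≤ Q * (X ∘L X†) := Commute.mul_nonneg hQ hXX hc
  have h3 : Q * (X ∘L X†) = 0 := le_antisymm (by rw [h1]; exact neg_nonpos.mpr hXPX) h2
  have h4 : ∀ v, X ((X†) (Q v)) = 0 := fun v => by
    have h := congrArg (fun B : F →L[ℂ] F => B v) (hc.eq.symm.trans h3)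
    simpa using h
  have h5 : ∀ v, (X†) (Q v) = 0 := fun v => by
    rw [← inner_self_eq_zero (𝕜 := ℂ), ContinuousLinearMap.adjoint_inner_left, h4, inner_zero_right]
  ext x
  refine ext_inner_right ℂ fun v => ?_
  have hQs : Q† = Q := hQ.isSelfAdjoint
  rw [ContinuousLinearMap.comp_apply, ← hQs, ContinuousLinearMap.adjoint_inner_left,
    ← ContinuousLinearMap.adjoint_inner_right, h5]
  simp

lemma defectOp_nonneg (A : E →L[ℂ] F) : 0 ≤ defectOp A := CFC.sqrt_nonneg _

lemma adjoint_defectOp (A : E →L[ℂ] F) : (defectOp A)† = defectOp A :=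
  (defectOp_nonneg A).isSelfAdjoint

lemma defectOp_defectOp {A : E →L[ℂ] F} (hA : ‖A‖ ≤ 1) (x : E) :
    defectOp A (defectOp A x) = x - (A†) (A x) := by
  have h : defectOp A * defectOp A = 1 - A† ∘L A := CFC.sqrt_mul_sqrt_self _ (one_sub_nonneg hA)
  simpa using congrArg (fun B : E →L[ℂ] E => B x) h

lemma defectOp_adjoint_defectOp_adjoint {A : E →L[ℂ] F} (hA : ‖A‖ ≤ 1) (x : F) :
    defectOp (A†) (defectOp (A†) x) = x - A ((A†) x) := by
  have h := defectOp_defectOp (A := A†) (by simpa using hA) x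
  rwa [ContinuousLinearMap.adjoint_adjoint] at h

/-- The defect operators of a contraction and of its adjoint are intertwined by the contraction. -/
lemma apply_defectOp {A : E →L[ℂ] F} (hA : ‖A‖ ≤ 1) (x : E) :
    A (defectOp A x) = defectOp (A†) (A x) := by
  have hPP := defectOp_defectOp hA
  have hQQ := defectOp_adjoint_defectOp_adjoint hA
  set P := defectOp A with hP
  set Q := defectOp (A†) with hQ
  -- From `Q² A = A - A A⋆ A = A P²` one gets `Q X = -X P`, so both sides vanish by the previous
  -- lemma. Then `X X⋆ = Q A X⋆`, hence `X⋆ X X⋆ = 0` and finally `X = 0`. No approximation of the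
  -- square root by polynomials is involved.
  let X : E →L[ℂ] F := Q ∘L A - A ∘L P
  have hX : Q ∘L X = -(X ∘L P) := by
    ext x
    simp [X, hPP, hQQ]
  have hQX := eq_zero_of_comp_eq_neg_comp (defectOp_nonneg A) (defectOp_nonneg (A†)) hX
  have hXP : X ∘L P = 0 := by rwa [hX, neg_eq_zero] at hQX
  have hPX : ∀ v, P ((X†) v) = 0 := fun v => by
    refine ext_inner_right ℂ fun u => ?_
    rw [hP, ← adjoint_defectOp, ContinuousLinearMap.adjoint_inner_left,
      ContinuousLinearMap.adjoint_inner_left, ← ContinuousLinearMap.comp_apply, ← hP, hXP]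
    simp
  have hXQ : ∀ v, (X†) (Q v) = 0 := fun v => by
    refine ext_inner_right ℂ fun u => ?_
    rw [ContinuousLinearMap.adjoint_inner_left, hQ, ← adjoint_defectOp (A†),
      ContinuousLinearMap.adjoint_inner_left, ← ContinuousLinearMap.comp_apply, ← hQ, hQX]
    simp
  have h1 : ∀ v, (X†) (X ((X†) v)) = 0 := fun v => by
    have h : X ((X†) v) = Q (A ((X†) v)) - A (P ((X†) v)) := rfl
    rw [hPX, map_zero, sub_zero] at h
    rw [h, hXQ]
  have h2 : ∀ v, X ((X†) v) = 0 := fun v => by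
    rw [← inner_self_eq_zero (𝕜 := ℂ), ← ContinuousLinearMap.adjoint_inner_left, h1,
      inner_zero_left]
  have h3 : ∀ v, (X†) v = 0 := fun v => by
    rw [← inner_self_eq_zero (𝕜 := ℂ), ContinuousLinearMap.adjoint_inner_left, h2,
      inner_zero_right]
  have h4 : X x = 0 := by
    rw [← inner_self_eq_zero (𝕜 := ℂ), ← ContinuousLinearMap.adjoint_inner_left, h3,
      inner_zero_left]
  exact (sub_eq_zero.mp (by simpa [X] using h4)).symm

lemma adjoint_apply_defectOp_adjoint {A : E →L[ℂ] F} (hA : ‖A‖ ≤ 1) (x : F) :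
    (A†) (defectOp (A†) x) = defectOp A ((A†) x) := by
  have h := apply_defectOp (A := A†) (by simpa using hA) x
  rwa [ContinuousLinearMap.adjoint_adjoint] at h

lemma norm_sq_apply_add_norm_sq_defectOp {A : E →L[ℂ] F} (hA : ‖A‖ ≤ 1) (x : E) :
    ‖A x‖ ^ 2 + ‖defectOp A x‖ ^ 2 = ‖x‖ ^ 2 := by
  have h : ⟪defectOp A x, defectOp A x⟫_ℂ = ⟪x, x⟫_ℂ - ⟪A x, A x⟫_ℂ := by
    nth_rewrite 1 [← adjoint_defectOp A]
    rw [ContinuousLinearMap.adjoint_inner_left, defectOp_defectOp hA, inner_sub_right,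
      ContinuousLinearMap.adjoint_inner_right]
  have h' := congrArg RCLike.re h
  rw [map_sub, inner_self_eq_norm_sq, inner_self_eq_norm_sq, inner_self_eq_norm_sq] at h'
  linarith

/-- The kernel of the coisometry `(x, c) ↦ A x + D_{A⋆} c`, parametrized by the defect space. -/
lemma exists_mem_defectSpace_of_add_eq_zero {A : E →L[ℂ] F} (hA : ‖A‖ ≤ 1) {x : E} {c : F}
    (hc : c ∈ defectSpace (A†)) (h : A x + defectOp (A†) c = 0) :
    ∃ y ∈ defectSpace A, defectOp A y = x ∧ A y = -c := by
  -- The witness is forced: if `x = D_A y` and `c = -A y`, then `D_A x - A⋆ c = D_A² y + A⋆ A y =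
  -- y`.
  refine ⟨defectOp A x - (A†) c, sub_mem (mem_closedRange _ _) ?_, ?_, ?_⟩
  · simpa using contraction_maps_defectSpace (A := A†) (by simpa using hA) hc
  · rw [map_sub, defectOp_defectOp hA, ← adjoint_apply_defectOp_adjoint hA, sub_sub, ← map_add, h,
      map_zero, sub_zero]
  · have h1 := defectOp_adjoint_defectOp_adjoint hA c
    rw [map_sub, apply_defectOp hA, ← sub_eq_zero, sub_neg_eq_add]
    have h2 : defectOp (A†) (A x) + defectOp (A†) (defectOp (A†) c) = 0 := by
      rw [← map_add, h, map_zero]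
    rw [h1] at h2
    rw [← h2]
    abel

variable {E' : Type*} [NormedAddCommGroup E'] [InnerProductSpace ℂ E'] [CompleteSpace E']

/-- The conjugate of `D_A` by `U` is positive with square `1 - B⋆ B`, and positive square roots are
unique. Used with `U` the identification of `H̃^n` with `H^n`. -/
lemma defectOp_comp_isometryEquiv {A : E →L[ℂ] F} (hA : ‖A‖ ≤ 1) (U : E' ≃ₗᵢ[ℂ] E) {B : E' →L[ℂ] F}
    (hB : ∀ x, B x = A (U x)) (x : E') : defectOp B x = U.symm (defectOp A (U x)) := by
  have hU : ((U : E' →L[ℂ] E)†) = (U.symm : E →L[ℂ] E') := by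
    exact LinearIsometryEquiv.adjoint_eq_symm U
  have h : defectOp B = (U.symm : E →L[ℂ] E') ∘L defectOp A ∘L (U : E' →L[ℂ] E) := by
    refine CFC.sqrt_unique ?_ ?_
    · ext x
      have hB' : ∀ v, (B†) v = U.symm ((A†) v) := fun v => by
        refine ext_inner_right ℂ fun u => ?_
        rw [ContinuousLinearMap.adjoint_inner_left, hB, ← U.inner_map_map,
          LinearIsometryEquiv.apply_symm_apply, ContinuousLinearMap.adjoint_inner_left]
      simp [defectOp_defectOp hA, hB, hB']
    · rw [← hU, ContinuousLinearMap.nonneg_iff_isPositive]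
      exact ((ContinuousLinearMap.nonneg_iff_isPositive _).mp (defectOp_nonneg A)).adjoint_conj
        (U : E' →L[ℂ] E)
  rw [h]
  rfl

lemma mem_defectSpace_comp_isometryEquiv {A : E →L[ℂ] F} (hA : ‖A‖ ≤ 1) (U : E' ≃ₗᵢ[ℂ] E)
    {B : E' →L[ℂ] F} (hB : ∀ x, B x = A (U x)) {x : E'} :
    x ∈ defectSpace B ↔ U x ∈ defectSpace A := by
  have h := defectOp_comp_isometryEquiv hA U hB
  have h1 : ((defectOp B).range : Set E') = U ⁻¹' ((defectOp A).range : Set E) := by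
    ext v
    constructor
    · rintro ⟨w, rfl⟩
      exact ⟨U w, by simp [h]⟩
    · rintro ⟨w, hw⟩
      refine ⟨U.symm w, ?_⟩
      have : defectOp A w = U v := hw
      simp [h, this]
  rw [defectSpace, defectSpace, closedRange, closedRange, ← SetLike.mem_coe, ← SetLike.mem_coe,
    Submodule.topologicalClosure_coe, Submodule.topologicalClosure_coe, h1]
  have h2 := U.toHomeomorph.preimage_closure ((defectOp A).range : Set E)
  exact (Set.ext_iff.mp h2 x).symm

end DefectIntertwining

/-! ### The case `m = 1`: identification of the spaces, and the isometry `j` -/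

section Wandering

variable {H : Type*} [NormedAddCommGroup H] [InnerProductSpace ℂ H] [CompleteSpace H] {n : ℕ}
  {T : Fin n → H →L[ℂ] H}

namespace IsRowContraction

lemma C_eq (hT : IsRowContraction T) : hT.isHypercontraction.C = defectOp ((row T)†) := by
  rw [IsHypercontraction.C, defectOp, defectOrder_one, ContinuousLinearMap.adjoint_adjoint]

lemma D_eq (hT : IsRowContraction T) : hT.isHypercontraction.D = defectSpace ((row T)†) := by
  rw [IsHypercontraction.D, C_eq hT]
  rfl

/-- The identity map `H → H̃`, which is isometric for `m = 1`. -/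
def inclIsometry (hT : IsRowContraction T) : H ≃ₗᵢ[ℂ] hT.isHypercontraction.Tilde where
  toLinearEquiv := hT.isHypercontraction.incl.toLinearEquiv
  norm_map' x := by
    refine (sq_eq_sq₀ (norm_nonneg _) (norm_nonneg _)).mp ?_
    refine (norm_toRenormedₗ_sq _ hT.isHypercontraction.one_le_defectSum x).trans ?_
    simp only [defectSum, Finset.sum_range_one, defectOrder_zero, one_apply_eq_self,
      inner_self_eq_norm_sq]

/-- The identification of `H̃^n` with `H^n` for `m = 1`. -/
def tildeIsometry (hT : IsRowContraction T) :
    PiLp 2 (fun _ : Fin n => hT.isHypercontraction.Tilde) ≃ₗᵢ[ℂ] PiLp 2 (fun _ : Fin n => H) :=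
  LinearIsometryEquiv.piLpCongrRight 2 fun _ => hT.inclIsometry.symm

lemma tildeIsometry_apply (hT : IsRowContraction T)
    (y : PiLp 2 (fun _ : Fin n => hT.isHypercontraction.Tilde)) (i : Fin n) :
    hT.tildeIsometry y i = hT.isHypercontraction.incl.symm (y i) := rfl

lemma tildeIsometry_symm_apply (hT : IsRowContraction T)
    (y : PiLp 2 (fun _ : Fin n => H)) (i : Fin n) :
    hT.tildeIsometry.symm y i = hT.isHypercontraction.incl (y i) := rfl

/-- The adjoint of `I_1` is its inverse, since `I_1⋆ I_1 = defectSum T 1 = 1`. -/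
lemma tildeRow_apply (hT : IsRowContraction T)
    (y : PiLp 2 (fun _ : Fin n => hT.isHypercontraction.Tilde)) :
    hT.isHypercontraction.tildeRow y = row T (hT.tildeIsometry y) := by
  rw [IsHypercontraction.tildeRow, row_apply, row_apply]
  refine Finset.sum_congr rfl fun i _ => ?_
  rw [tildeIsometry_apply, ContinuousLinearMap.comp_apply]
  obtain ⟨x, hx⟩ := hT.isHypercontraction.incl.surjective (y i)
  rw [← hx, IsHypercontraction.incl_adjoint_apply]
  simp [defectSum, defectOrder_zero]

/-- The operator `D_{T⋆}`, with values in the space `𝒟`. -/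
def defectToD (hT : IsRowContraction T) : H →L[ℂ] hT.isHypercontraction.D :=
  hT.isHypercontraction.C.codRestrict _ (mem_closedRange _)

lemma coe_defectToD (hT : IsRowContraction T) (x : H) :
    (hT.defectToD x : H) = defectOp ((row T)†) x := by
  rw [← C_eq hT]
  rfl

lemma defectToD_adjoint (hT : IsRowContraction T) (u : hT.isHypercontraction.D) :
    (hT.defectToD†) u = defectOp ((row T)†) u := by
  refine ext_inner_right ℂ fun x => ?_
  rw [ContinuousLinearMap.adjoint_inner_left, Submodule.coe_inner, coe_defectToD,
    ← adjoint_defectOp ((row T)†), ContinuousLinearMap.adjoint_inner_left, adjoint_defectOp]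

lemma defectToD_adjoint_comp_add (hT : IsRowContraction T) :
    hT.defectToD† ∘L hT.defectToD + row T ∘L (row T)† = 1 := by
  ext x
  rw [add_apply, ContinuousLinearMap.comp_apply, defectToD_adjoint, coe_defectToD,
    defectOp_adjoint_defectOp_adjoint hT.contraction]
  simp

/-- Links the resolvent in `j` and `θ_T` to the one that defines `π` on kernel functions. -/
lemma ballResolvent_adjoint (T : Fin n → H →L[ℂ] H) (z : UnitBall n) :
    (ballResolvent T z)†
      = Ring.inverse (1 - ∑ i, starRingEnd ℂ ((z : EuclideanSpace ℂ (Fin n)) i) • T i) := by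
  rw [ballResolvent, ← ContinuousLinearMap.star_eq_adjoint, ← Ring.inverse_star]
  congr 1
  rw [star_sub, star_one, ContinuousLinearMap.star_eq_adjoint, ContinuousLinearMap.adjoint_comp,
    ContinuousLinearMap.adjoint_adjoint]
  congr 1
  ext x
  simp only [ContinuousLinearMap.comp_apply, zRow, row_adjoint_apply, row_apply, sum_apply]
  refine Finset.sum_congr rfl fun i _ => ?_
  rw [LinearIsometryEquiv.map_smulₛₗ]
  simp [ContinuousLinearMap.adjoint_id]

/-- The canonical dilation `j` of a pure row contraction to the Drury-Arveson space. -/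
lemma exists_dilation (hT : IsRowContraction T) (hpure : IsPure T) :
    ∃ j : H →ₗᵢ[ℂ] BallSpace n 1 hT.isHypercontraction.D,
      (∀ x z, (j x z : H) = defectOp ((row T)†) (ballResolvent T z x)) ∧
      (∀ x u, ⟪j x, RKHS.kerFun (BallSpace n 1 hT.isHypercontraction.D) (ballZero n) u⟫_ℂ
        = ⟪x, defectOp ((row T)†) u⟫_ℂ) ∧
      ∀ i x f, ⟪j x, mulCoord n 1 hT.isHypercontraction.D i f⟫_ℂ = ⟪j (((T i)†) x), f⟫_ℂ := by
  have hC := hT.defectToD_adjoint_comp_add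
  obtain ⟨π, hπ1, hπ⟩ := exists_dilationAdjoint hC
  have hM := dilationAdjoint_mulCoord hC hT.comm hπ
  have h0 : ∀ u, π (RKHS.kerFun (BallSpace n 1 hT.isHypercontraction.D) (ballZero n) u)
      = (hT.defectToD†) u := fun u => by
    rw [hπ]
    simp [ballZero_apply]
  have hnorm := norm_adjoint_dilationAdjoint hC hpure hπ1 h0 hM
  -- Take `j = π⋆`. The last two clauses describe `j⋆` on constants and on multiples of coordinates,
  -- which together determine `j⋆ f` by the decomposition of `f`.
  refine ⟨⟨(π†).toLinearMap, hnorm⟩, fun x z => ?_, fun x u => ?_, fun i x f => ?_⟩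
  · change (((π†) x) z : H) = _
    rw [← coe_defectToD]
    congr 1
    refine ext_inner_left ℂ fun u => ?_
    rw [← RKHS.kerFun_inner, ContinuousLinearMap.adjoint_inner_right, hπ, ← ballResolvent_adjoint,
      ContinuousLinearMap.adjoint_inner_left, ContinuousLinearMap.adjoint_inner_left]
  · change ⟪(π†) x, _⟫_ℂ = _
    rw [ContinuousLinearMap.adjoint_inner_left, h0, defectToD_adjoint]
  · change ⟪(π†) x, _⟫_ℂ = ⟪(π†) _, _⟫_ℂ
    rw [ContinuousLinearMap.adjoint_inner_left, ContinuousLinearMap.adjoint_inner_left, hM,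
      ContinuousLinearMap.adjoint_inner_left]

end IsRowContraction

end Wandering

/-! ### The characteristic function and the wandering subspace -/

section Main

variable {H : Type*} [NormedAddCommGroup H] [InnerProductSpace ℂ H] [CompleteSpace H] {n : ℕ}
  {T : Fin n → H →L[ℂ] H}

namespace IsRowContraction

lemma theta_apply (hT : IsRowContraction T) (z : UnitBall n) (y : defectSpace (row T)) :
    (hT.theta z y : H) = -row T y + defectOp ((row T)†) (ballResolvent T z
      (zRow H z (defectOp (row T) y))) := rfl

lemma W_apply (hT : IsRowContraction T) (z : UnitBall n) (y : hT.isHypercontraction.Dtilde) :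
    (hT.isHypercontraction.W z y : H) = -row T (hT.tildeIsometry y)
      + defectOp ((row T)†) (ballResolvent T z
        (zRow H z (defectOp (row T) (hT.tildeIsometry y)))) := by
  have h : (hT.isHypercontraction.W z y : H) = -hT.isHypercontraction.tildeRow y
      + hT.isHypercontraction.C ((∑ k ∈ Finset.Icc 1 1, ballResolvent T z ^ k)
        (hT.isHypercontraction.incl.symm (zRow hT.isHypercontraction.Tilde z
          (defectOp hT.isHypercontraction.tildeRow y)))) := rfl
  rw [h, hT.tildeRow_apply, hT.C_eq, Finset.Icc_self, Finset.sum_singleton, pow_one,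
    defectOp_comp_isometryEquiv hT.contraction hT.tildeIsometry hT.tildeRow_apply]
  congr 3
  simp [zRow, row_apply, tildeIsometry_symm_apply]

lemma tildeIsometry_mem_defectSpace (hT : IsRowContraction T)
    (y : PiLp 2 (fun _ : Fin n => hT.isHypercontraction.Tilde)) :
    y ∈ defectSpace hT.isHypercontraction.tildeRow ↔ hT.tildeIsometry y ∈ defectSpace (row T) :=
  mem_defectSpace_comp_isometryEquiv hT.contraction hT.tildeIsometry hT.tildeRow_apply

/-- The inclusion of `𝒟̃` into `𝒟_T`. -/
def dtildeIsometry (hT : IsRowContraction T) :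
    hT.isHypercontraction.Dtilde →ₗᵢ[ℂ] defectSpace (row T) where
  toLinearMap := (hT.tildeIsometry.toLinearEquiv.toLinearMap
    ∘ₗ hT.isHypercontraction.Dtilde.subtype).codRestrict _
      fun y => (hT.tildeIsometry_mem_defectSpace _).mp y.2.1
  norm_map' y := hT.tildeIsometry.norm_map y

lemma coe_dtildeIsometry (hT : IsRowContraction T) (y : hT.isHypercontraction.Dtilde) :
    (hT.dtildeIsometry y : PiLp 2 (fun _ : Fin n => H)) = hT.tildeIsometry y := rfl

section Dilation

variable (hT : IsRowContraction T) {j : H →ₗᵢ[ℂ] BallSpace n 1 hT.isHypercontraction.D}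

lemma mem_rangeJ_iff (hj : ∀ x z, (j x z : H) = defectOp ((row T)†) (ballResolvent T z x))
    {f : BallSpace n 1 hT.isHypercontraction.D} :
    f ∈ hT.isHypercontraction.rangeJ ↔ ∃ x, j x = f := by
  constructor
  · rintro ⟨x, hx⟩
    refine ⟨x, RKHS.ext fun z => Subtype.ext ?_⟩
    rw [hj, hx, hT.C_eq, pow_one]
  · rintro ⟨x, rfl⟩
    exact ⟨x, fun z => by rw [hj, hT.C_eq, pow_one]⟩

lemma mem_Dtilde_iff (hj : ∀ x z, (j x z : H) = defectOp ((row T)†) (ballResolvent T z x))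
    {y : PiLp 2 (fun _ : Fin n => hT.isHypercontraction.Tilde)} :
    y ∈ hT.isHypercontraction.Dtilde ↔ hT.tildeIsometry y ∈ defectSpace (row T) ∧
      ∃ f : BallSpace n 1 hT.isHypercontraction.D, ∀ i,
        ((mulCoord n 1 hT.isHypercontraction.D i)†) f
          = j (defectOp (row T) (hT.tildeIsometry y) i) := by
  rw [← tildeIsometry_mem_defectSpace]
  refine and_congr_right fun _ => exists_congr fun f => forall_congr' fun i => ?_
  rw [defectOp_comp_isometryEquiv hT.contraction hT.tildeIsometry hT.tildeRow_apply,
    tildeIsometry_symm_apply, ContinuousLinearEquiv.symm_apply_apply]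
  have hC : ∀ x z, hT.isHypercontraction.C ((ballResolvent T z ^ 1) x) = (j x z : H) :=
    fun x z => by rw [pow_one, hj, hT.C_eq]
  simp only [hC]
  exact ⟨fun h => RKHS.ext fun z => Subtype.ext (h z), fun h z => by rw [h]⟩

lemma mem_M_iff (hj : ∀ x z, (j x z : H) = defectOp ((row T)†) (ballResolvent T z x))
    {f : BallSpace n 1 hT.isHypercontraction.D} :
    f ∈ hT.isHypercontraction.M ↔ ∀ x, ⟪j x, f⟫_ℂ = 0 := by
  rw [IsHypercontraction.M, Submodule.mem_orthogonal]
  constructor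
  · exact fun h x => h _ ((hT.mem_rangeJ_iff hj).mpr ⟨x, rfl⟩)
  · intro h g hg
    obtain ⟨x, rfl⟩ := (hT.mem_rangeJ_iff hj).mp hg
    exact h x

/-- Orthogonality to every `M_{z_i} M` means `M_{z_i}⋆ f ∈ M^⊥`, and `M^⊥` is `Im j` itself because
the range of an isometry on a complete space is closed. -/
lemma mem_wandering_iff (hj : ∀ x z, (j x z : H) = defectOp ((row T)†) (ballResolvent T z x))
    {f : BallSpace n 1 hT.isHypercontraction.D} :
    f ∈ hT.isHypercontraction.wandering ↔ (∀ x, ⟪j x, f⟫_ℂ = 0) ∧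
      ∃ x : PiLp 2 (fun _ : Fin n => H), ∀ i,
        ((mulCoord n 1 hT.isHypercontraction.D i)†) f = j (x i) := by
  rw [IsHypercontraction.wandering, Submodule.mem_inf, hT.mem_M_iff hj]
  refine and_congr_right fun _ => ?_
  have hcl : hT.isHypercontraction.Mᗮ = hT.isHypercontraction.rangeJ := by
    have h1 : hT.isHypercontraction.rangeJ = j.toLinearMap.range := by
      ext g
      exact hT.mem_rangeJ_iff hj
    have h2 : IsClosed (hT.isHypercontraction.rangeJ : 
        Set (BallSpace n 1 hT.isHypercontraction.D)) := by
      rw [h1]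
      exact j.isometry.isClosedEmbedding.isClosed_range
    rw [IsHypercontraction.M, Submodule.orthogonal_orthogonal_eq_closure]
    exact IsClosed.submodule_topologicalClosure_eq h2
  have h3 : f ∈ (⨆ i, hT.isHypercontraction.M.map
      (mulCoord n 1 hT.isHypercontraction.D i).toLinearMap)ᗮ ↔
      ∀ i, ((mulCoord n 1 hT.isHypercontraction.D i)†) f ∈ hT.isHypercontraction.Mᗮ := by
    rw [← Submodule.iInf_orthogonal, Submodule.mem_iInf]
    refine forall_congr' fun i => ?_
    rw [Submodule.mem_orthogonal, Submodule.mem_orthogonal]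
    constructor
    · intro h g hg
      rw [ContinuousLinearMap.adjoint_inner_right]
      exact h _ ⟨g, hg, rfl⟩
    · rintro h _ ⟨g, hg, rfl⟩
      have h4 := h g hg
      rwa [ContinuousLinearMap.adjoint_inner_right] at h4
  rw [h3, hcl]
  simp only [hT.mem_rangeJ_iff hj]
  constructor
  · intro h
    choose x hx using h
    exact ⟨WithLp.toLp 2 x, fun i => (hx i).symm⟩
  · rintro ⟨x, hx⟩ i
    exact ⟨x i, (hx i).symm⟩

lemma coe_const_add_sum_apply
    (hj : ∀ x z, (j x z : H) = defectOp ((row T)†) (ballResolvent T z x))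
    (c : hT.isHypercontraction.D) (x : PiLp 2 (fun _ : Fin n => H)) (z : UnitBall n) :
    ((RKHS.kerFun (BallSpace n 1 hT.isHypercontraction.D) (ballZero n) c
        + ∑ i, mulCoord n 1 hT.isHypercontraction.D i (j (x i))) z : H)
      = c + defectOp ((row T)†) (ballResolvent T z (zRow H z x)) := by
  rw [RKHS.coe_add, Pi.add_apply, kerFun_ballZero_apply, sum_ballSpace_apply]
  simp [mulCoord_apply, hj, zRow, row_apply]

/-- Computes `j⋆(c + ∑ z_i j x_i) = T x + D_{T⋆} c`, using `j⋆ j = 1`. -/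
lemma inner_const_add_sum
    (hj0 : ∀ x u, ⟪j x, RKHS.kerFun (BallSpace n 1 hT.isHypercontraction.D) (ballZero n) u⟫_ℂ
        = ⟪x, defectOp ((row T)†) u⟫_ℂ)
    (hjM : ∀ i x f, ⟪j x, mulCoord n 1 hT.isHypercontraction.D i f⟫_ℂ = ⟪j (((T i)†) x), f⟫_ℂ)
    (c : hT.isHypercontraction.D) (x : PiLp 2 (fun _ : Fin n => H)) (v : H) :
    ⟪j v, RKHS.kerFun (BallSpace n 1 hT.isHypercontraction.D) (ballZero n) c
        + ∑ i, mulCoord n 1 hT.isHypercontraction.D i (j (x i))⟫_ℂ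
      = ⟪v, row T x + defectOp ((row T)†) c⟫_ℂ := by
  rw [inner_add_right, inner_sum, hj0, inner_add_right, add_comm, row_apply, inner_sum]
  congr 1
  refine Finset.sum_congr rfl fun i _ => ?_
  rw [hjM, LinearIsometry.inner_map_map, ContinuousLinearMap.adjoint_inner_left]

/-- Each vector of `𝒟̃` yields a function of the same norm in the wandering subspace. -/
lemma exists_mem_wandering
    (hj : ∀ x z, (j x z : H) = defectOp ((row T)†) (ballResolvent T z x))
    (hj0 : ∀ x u, ⟪j x, RKHS.kerFun (BallSpace n 1 hT.isHypercontraction.D) (ballZero n) u⟫_ℂ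
        = ⟪x, defectOp ((row T)†) u⟫_ℂ)
    (hjM : ∀ i x f, ⟪j x, mulCoord n 1 hT.isHypercontraction.D i f⟫_ℂ = ⟪j (((T i)†) x), f⟫_ℂ)
    (y : hT.isHypercontraction.Dtilde) :
    ∃ f : hT.isHypercontraction.wandering,
      (∀ z, ((f : BallSpace n 1 hT.isHypercontraction.D) z : H)
        = hT.theta z (hT.dtildeIsometry y)) ∧ ‖f‖ = ‖y‖ := by
  obtain ⟨hy, g, hg⟩ := (hT.mem_Dtilde_iff hj).mp y.2
  set v := hT.tildeIsometry y with hv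
  set x := defectOp (row T) v with hx
  have hc : -row T v ∈ hT.isHypercontraction.D := by
    rw [hT.D_eq]
    exact neg_mem (contraction_maps_defectSpace hT.contraction hy)
  let c : hT.isHypercontraction.D := ⟨-row T v, hc⟩
  set f := RKHS.kerFun (BallSpace n 1 hT.isHypercontraction.D) (ballZero n) c
        + ∑ i, mulCoord n 1 hT.isHypercontraction.D i (j (x i)) with hf
  have hfz : ∀ z, (f z : H) = hT.theta z (hT.dtildeIsometry y) :=
    fun z => hT.coe_const_add_sum_apply hj c x z
  have hf0 : f (ballZero n) = c := by
    refine Subtype.ext ((hT.coe_const_add_sum_apply hj c x _).trans ?_)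
    simp [zRow, row_apply, ballZero_apply]
  -- The condition defining `𝒟̃` enters here. By the decomposition of `g`, the functions `f` and `g`
  -- differ by a constant, and constants are killed by every `M_{z_i}⋆`; so `M_{z_i}⋆ f = j x_i` as
  -- well.
  have hfg : f = g + RKHS.kerFun (BallSpace n 1 hT.isHypercontraction.D) (ballZero n)
      (c - g (ballZero n)) := by
    have h := kerFun_ballZero_add_sum g
    simp only [hg] at h
    rw [hf, map_sub, eq_sub_iff_add_eq'.mpr h]
    abel
  have hfM : ∀ i, ((mulCoord n 1 hT.isHypercontraction.D i)†) f = j (x i) := fun i => by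
    rw [hfg, map_add, mulCoord_adjoint_kerFun_ballZero, add_zero, hg]
  refine ⟨⟨f, (hT.mem_wandering_iff hj).mpr ⟨fun u => ?_, x, hfM⟩⟩, hfz, ?_⟩
  · rw [hf, hT.inner_const_add_sum hj0 hjM]
    -- Here `x = D_T v` and `c = -T v`, so this is `T D_T = D_{T⋆} T`.
    have h : row T x + defectOp ((row T)†) c = 0 := by
      rw [hx, apply_defectOp hT.contraction]
      simp [c]
    rw [h, inner_zero_right]
  · refine (sq_eq_sq₀ (norm_nonneg _) (norm_nonneg _)).mp ?_
    have h1 : ‖y‖ = ‖v‖ := (hT.tildeIsometry.norm_map y).symm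
    rw [h1, ← norm_sq_apply_add_norm_sq_defectOp hT.contraction, Submodule.coe_norm,
      norm_sq_eq_add_sum f, hf0, ← hx, PiLp.norm_sq_eq_of_L2 _ x]
    simp only [hfM, LinearIsometry.norm_map]
    simp [c]

/-- Each function in the wandering subspace arises from a vector of `𝒟̃`. -/
lemma exists_of_mem_wandering
    (hj : ∀ x z, (j x z : H) = defectOp ((row T)†) (ballResolvent T z x))
    (hj0 : ∀ x u, ⟪j x, RKHS.kerFun (BallSpace n 1 hT.isHypercontraction.D) (ballZero n) u⟫_ℂ
        = ⟪x, defectOp ((row T)†) u⟫_ℂ)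
    (hjM : ∀ i x f, ⟪j x, mulCoord n 1 hT.isHypercontraction.D i f⟫_ℂ = ⟪j (((T i)†) x), f⟫_ℂ)
    (f : hT.isHypercontraction.wandering) :
    ∃ y : hT.isHypercontraction.Dtilde, ∀ z,
      ((f : BallSpace n 1 hT.isHypercontraction.D) z : H) = hT.theta z (hT.dtildeIsometry y) := by
  obtain ⟨f, hf⟩ := f
  obtain ⟨hfM, x, hx⟩ := (hT.mem_wandering_iff hj).mp hf
  have hsum := kerFun_ballZero_add_sum f
  simp only [hx] at hsum
  have h0 : row T x + defectOp ((row T)†) (f (ballZero n)) = 0 := by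
    refine ext_inner_left ℂ fun v => ?_
    rw [← hT.inner_const_add_sum hj0 hjM, hsum, hfM, inner_zero_right]
  -- This yields `D_T v = x` and `T v = -f(0)`. Membership of `v` in `𝒟̃` is then witnessed by `f`
  -- itself.
  obtain ⟨v, hv, hvx, hvc⟩ := exists_mem_defectSpace_of_add_eq_zero hT.contraction
    (hT.D_eq ▸ (f (ballZero n)).2) h0
  refine ⟨⟨hT.tildeIsometry.symm v, (hT.mem_Dtilde_iff hj).mpr ⟨?_, f, ?_⟩⟩, fun z => ?_⟩
  · rwa [LinearIsometryEquiv.apply_symm_apply]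
  · rw [LinearIsometryEquiv.apply_symm_apply, hvx]
    exact hx
  · rw [theta_apply, coe_dtildeIsometry, LinearIsometryEquiv.apply_symm_apply, hvx, hvc, neg_neg,
      ← hT.coe_const_add_sum_apply hj, hsum]

end Dilation

lemma exists_unitary (hT : IsRowContraction T) (hpure : IsPure T) :
    ∃ U : hT.isHypercontraction.Dtilde ≃ₗᵢ[ℂ] hT.isHypercontraction.wandering,
      ∀ (y : hT.isHypercontraction.Dtilde) (z : UnitBall n),
        ((U y : BallSpace n 1 hT.isHypercontraction.D) z : H)
          = hT.theta z (hT.dtildeIsometry y) := by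
  obtain ⟨j, hj, hj0, hjM⟩ := hT.exists_dilation hpure
  choose V hV hVn using hT.exists_mem_wandering hj hj0 hjM
  have hext : ∀ f g : hT.isHypercontraction.wandering,
      (∀ z, ((f : BallSpace n 1 hT.isHypercontraction.D) z : H)
        = (g : BallSpace n 1 hT.isHypercontraction.D) z) → f = g :=
    fun f g h => Subtype.ext (RKHS.ext fun z => Subtype.ext (h z))
  let L : hT.isHypercontraction.Dtilde →ₗᵢ[ℂ] hT.isHypercontraction.wandering :=
    { toFun := V
      map_add' := fun x y => hext _ _ fun z => by simp [hV]
      map_smul' := fun a x => hext _ _ fun z => by simp [hV]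
      norm_map' := hVn }
  refine ⟨LinearIsometryEquiv.ofSurjective L fun f => ?_, hV⟩
  obtain ⟨y, hy⟩ := hT.exists_of_mem_wandering hj hj0 hjM f
  exact ⟨y, hext _ _ fun z => (hV y z).trans (hy z).symm⟩

end IsRowContraction

end Main

end RowContraction

end

theorem mainTheorem6 {H : Type*} [NormedAddCommGroup H] [InnerProductSpace ℂ H] [CompleteSpace H]
    {n : ℕ} (T : Fin n → H →L[ℂ] H) (hT : RowContraction.IsRowContraction T)
    (hpure : RowContraction.IsPure T) :
    -- both operator functions take values in the same space
    hT.isHypercontraction.D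
        = RowContraction.defectSpace (ContinuousLinearMap.adjoint (RowContraction.row T)) ∧
    -- `J` is the inclusion of `𝒟̃ ⊆ H̃^n` into `𝒟_T ⊆ H^n` given by the identity `H̃ = H`
    ∃ J : hT.isHypercontraction.Dtilde →ₗᵢ[ℂ] RowContraction.defectSpace (RowContraction.row T),
      (∀ y i, (J y : PiLp 2 (fun _ : Fin n => H)) i
        = hT.isHypercontraction.incl.symm
            ((y : PiLp 2 (fun _ : Fin n => hT.isHypercontraction.Tilde)) i)) ∧
      -- `W_T(z)` is the restriction of `θ_T(z)` to `𝒟̃`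
      (∀ (z : RowContraction.UnitBall n) (y : hT.isHypercontraction.Dtilde),
        (hT.isHypercontraction.W z y : H) = (hT.theta z (J y) : H)) ∧
      -- `x ↦ θ_T x` is a unitary operator from `𝒟̃` onto `W(M)`
      ∃ U : hT.isHypercontraction.Dtilde ≃ₗᵢ[ℂ] hT.isHypercontraction.wandering,
        ∀ (y : hT.isHypercontraction.Dtilde) (z : RowContraction.UnitBall n),
          ((U y : RowContraction.BallSpace n 1 hT.isHypercontraction.D) z : H)
            = (hT.theta z (J y) : H) :=
  ⟨hT.D_eq, hT.dtildeIsometry, fun _ _ => rfl, fun z y => hT.W_apply z y,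
    hT.exists_unitary hpure⟩
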